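/- Let $c\ge 0$ and let $\mathbb H_c=L^2(\mathbb R,e^{-2ct}\,dt)$ be the Hilbert space of complex-valued functions that are square-integrable for the measure $e^{-2ct}\,dt$. Let $\partial_c$ be the unbounded operator $f\mapsto f'$ on $\mathbb H_c$ whose domain consists of the $f\in\mathbb H_c$ that are (represented by) locally absolutely continuous functions on $\mathbb R$ with $f'\in\mathbb H_c$. Then the spectral operator $\mathfrak a_c=\zeta(\partial_c)$ is well defined by the measurable functional calculus for unbounded normal operators: there is a resolution of the identity $E$ on the Borel sets of $\mathbb C$ with $\partial_c=\int\lambda\,dE(\lambda)$, and $\mathfrak a_c=\int\zeta(\lambda)\,dE(\lambda)$, with domain $\{f\in\mathbb H_c:\int|\zeta(\lambda)|^2\,d\langle E(\lambda)f,f\rangle<\infty\}$, where $\zeta$ is the Riemann zeta function (its value at the pole $1$ is immaterial). Call an operator $A:D(A)\subset\mathbb H_c\to\mathbb H_c$ invertible if there is a bounded linear operator $B$ defined on all of $\mathbb H_c$, with range $D(A)$, such that $ABu=u$ for all $u\in\mathbb H_c$ and $BAv=v$ for all $v\in D(A)$. Put $L_c=\{s\in\mathbb C:\operatorname{Re}s=c,\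 s\ne 1\}$. Then $$\mathfrak a_c\text{ is invertible}\iff 0\notin\overline{\{\zeta(s):s\in L_c\}}.$$ Moreover, $0\notin\overline{\{\zeta(s):s\in L_c\}}$ if and only if $\zeta$ has no zeros on $L_c$ and there is no infinite sequence $(s_n)_{n\ge1}$ of distinct points of $L_c$ such that $\zeta(s_n)\to0$ as $n\to\infty$. -/

import Mathlib

open MeasureTheory

noncomputable section

namespace SpectralOp

section Abstract

variable {H : Type*} [NormedAddCommGroup H] [InnerProductSpace ℂ H] [CompleteSpace H]

/-- A resolution of the identity (projection-valued measure) on the Borel sets of `ℂ`, acting on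
the Hilbert space `H`. The value on non-measurable sets is fixed to be `0`. -/
structure ResolutionOfIdentity (H : Type*) [NormedAddCommGroup H] [InnerProductSpace ℂ H]
    [CompleteSpace H] where
  proj : Set ℂ → H →L[ℂ] H
  isStarProjection : ∀ s, MeasurableSet s → IsStarProjection (proj s)
  proj_of_not_measurable : ∀ s, ¬ MeasurableSet s → proj s = 0
  proj_univ : proj Set.univ = 1
  proj_inter : ∀ s t, MeasurableSet s → MeasurableSet t → proj (s ∩ t) = proj s * proj t
  hasSum_iUnion : ∀ s : ℕ → Set ℂ, (∀ n, MeasurableSet (s n)) →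
    Pairwise (Function.onFun Disjoint s) →
    ∀ x : H, HasSum (fun n => proj (s n) x) (proj (⋃ n, s n) x)

namespace ResolutionOfIdentity

theorem proj_empty (E : ResolutionOfIdentity H) (x : H) : E.proj ∅ x = 0 := by
  have h := E.hasSum_iUnion (fun _ => ∅) (fun _ => MeasurableSet.empty)
    (fun _ _ _ => disjoint_bot_left) x
  exact tendsto_nhds_unique tendsto_const_nhds h.summable.tendsto_atTop_zero

theorem re_inner_nonneg (E : ResolutionOfIdentity H) (x : H) {s : Set ℂ} (hs : MeasurableSet s) :
    0 ≤ (inner ℂ x (E.proj s x)).re := by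
  have hp := E.isStarProjection s hs
  have h1 : E.proj s x = E.proj s (E.proj s x) := by
    conv_lhs => rw [← hp.isIdempotentElem.eq]
    rfl
  have h2 : inner ℂ x (E.proj s x) = inner ℂ (E.proj s x) (E.proj s x) := by
    conv_lhs => rw [h1, ← ContinuousLinearMap.adjoint_inner_left,
      ← ContinuousLinearMap.star_eq_adjoint, hp.isSelfAdjoint.star_eq]
  rw [h2]
  exact inner_self_nonneg (𝕜 := ℂ)

/-- The scalar spectral measure `s ↦ ⟨E(s) x, x⟩`. -/
def scalarMeasure (E : ResolutionOfIdentity H) (x : H) : Measure ℂ :=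
  Measure.ofMeasurable (fun s _ => ENNReal.ofReal (inner ℂ x (E.proj s x)).re)
    (by simp [E.proj_empty])
    (by
      intro s hs hd
      have h := E.hasSum_iUnion s hs hd x
      have h2 : HasSum (fun n => (inner ℂ x (E.proj (s n) x)).re)
          (inner ℂ x (E.proj (⋃ n, s n) x)).re :=
        (h.mapL (innerSL ℂ x)).mapL Complex.reCLM
      rw [← h2.tsum_eq, ENNReal.ofReal_tsum_of_nonneg (fun n => E.re_inner_nonneg x (hs n))
        h2.summable])

/-- `E.IsIntegral φ A` says that `A` is the (possibly unbounded) operator `∫ φ dE`: its domain is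
`{x | ∫ |φ|² d⟨E x, x⟩ < ∞}`, and `⟨A x, x⟩ = ∫ φ d⟨E x, x⟩` there. By polarization, and since this
domain is dense, these conditions determine `A`. The Mathlib inner product is linear in its second
argument. -/
def IsIntegral (E : ResolutionOfIdentity H) (φ : ℂ → ℂ) (A : H →ₗ.[ℂ] H) : Prop :=
  (∀ x : H, x ∈ A.domain ↔ MemLp φ 2 (E.scalarMeasure x)) ∧
  ∀ x : A.domain, inner ℂ (x : H) (A x) = ∫ z, φ z ∂(E.scalarMeasure (x : H))

end ResolutionOfIdentity

/-- `A = φ(N)` in the sense of the measurable functional calculus for unbounded normal operators: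
`N = ∫ λ dE` and `A = ∫ φ dE` for a resolution of the identity `E` (the one of `N`; the spectral
theorem provides it for every normal `N`, and it is unique). -/
def IsFunctionOf (N : H →ₗ.[ℂ] H) (φ : ℂ → ℂ) (A : H →ₗ.[ℂ] H) : Prop :=
  ∃ E : ResolutionOfIdentity H, E.IsIntegral (fun z => z) N ∧ E.IsIntegral φ A

open Classical in
/-- The operator `φ(N)`. If there is no such operator (`N` is not normal or `φ` is not
measurable), the value is the zero operator with domain `{0}`. -/
def functionalCalculus (N : H →ₗ.[ℂ] H) (φ : ℂ → ℂ) : H →ₗ.[ℂ] H :=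
  if h : ∃ A, IsFunctionOf N φ A then h.choose else ⊥

/-- A possibly unbounded operator `A` is invertible if there is a bounded operator `B`, defined on
the whole space and with range the domain of `A`, such that `A B u = u` for all `u` and
`B A v = v` for all `v` in the domain of `A`. -/
def IsInvertible (A : H →ₗ.[ℂ] H) : Prop :=
  ∃ B : H →L[ℂ] H, Set.range B = A.domain ∧
    (∀ (u : H) (hu : B u ∈ A.domain), A ⟨B u, hu⟩ = u) ∧
    ∀ v : A.domain, B (A v) = v

end Abstract

/-- The measure `e^{-2ct} dt` on the real line. -/
def weight (c : ℝ) : Measure ℝ :=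
  (volume : Measure ℝ).withDensity fun t => ENNReal.ofReal (Real.exp (-2 * c * t))

/-- The weighted Hilbert space `L²(ℝ, e^{-2ct} dt)` of complex-valued functions. -/
abbrev Hc (c : ℝ) : Type := Lp ℂ 2 (weight c)

theorem volume_ac_weight (c : ℝ) : (volume : Measure ℝ) ≪ weight c := by
  refine withDensity_absolutelyContinuous' (by fun_prop) ?_
  filter_upwards with t
  simpa using Real.exp_pos _

theorem weight_ac_volume (c : ℝ) : weight c ≪ (volume : Measure ℝ) :=
  withDensity_absolutelyContinuous _ _

/-- Local absolute continuity on the real line. -/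
def IsAC (g : ℝ → ℂ) : Prop := ∀ a b : ℝ, AbsolutelyContinuousOnInterval g a b

theorem IsAC.continuous {g : ℝ → ℂ} (hg : IsAC g) : Continuous g := by
  rw [continuous_iff_continuousAt]
  intro x
  refine (hg (x - 1) (x + 1)).continuousOn.continuousAt ?_
  rw [Set.uIcc_of_le (by linarith)]
  exact Icc_mem_nhds (by linarith) (by linarith)

theorem IsAC.ae_differentiableAt {g : ℝ → ℂ} (hg : IsAC g) :
    ∀ᵐ t : ℝ, DifferentiableAt ℝ g t := by
  have h : LocallyBoundedVariationOn g Set.univ := by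
    intro a b _ _
    rcases le_total a b with hab | hab
    · have := (hg a b).boundedVariationOn
      rw [Set.uIcc_of_le hab] at this
      simpa [BoundedVariationOn] using this
    · have hsub : (Set.univ ∩ Set.Icc a b).Subsingleton := by
        rw [Set.univ_inter]
        exact Set.subsingleton_Icc_of_ge hab
      rw [BoundedVariationOn, eVariationOn.subsingleton _ hsub]
      simp
  exact h.ae_differentiableAt

/-- The graph of the infinitesimal shift: pairs `(f, h)` such that `f` has a locally absolutely
continuous representative `g` whose derivative represents `h`. -/
def shiftGraph (c : ℝ) : Submodule ℂ (Hc c × Hc c) where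
  carrier := {p | ∃ g : ℝ → ℂ, IsAC g ∧ p.1 =ᵐ[weight c] g ∧ p.2 =ᵐ[weight c] deriv g}
  zero_mem' := by
    refine ⟨fun _ => 0, fun a b => ?_, Lp.coeFn_zero _ _ _, ?_⟩
    · exact (LipschitzWith.const (0 : ℂ)).lipschitzOnWith.absolutelyContinuousOnInterval
    · filter_upwards [Lp.coeFn_zero ℂ 2 (weight c)] with t ht
      simpa using ht
  add_mem' := by
    rintro ⟨f₁, h₁⟩ ⟨f₂, h₂⟩ ⟨g₁, hg₁, hf₁, hh₁⟩ ⟨g₂, hg₂, hf₂, hh₂⟩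
    refine ⟨g₁ + g₂, fun a b => (hg₁ a b).add (hg₂ a b), (Lp.coeFn_add _ _).trans (hf₁.add hf₂), ?_⟩
    filter_upwards [Lp.coeFn_add h₁ h₂, hh₁, hh₂,
      (weight_ac_volume c).ae_le hg₁.ae_differentiableAt,
      (weight_ac_volume c).ae_le hg₂.ae_differentiableAt] with t e e₁ e₂ d₁ d₂
    change (h₁ + h₂ : Hc c) t = _
    rw [e, Pi.add_apply, e₁, e₂, deriv_add d₁ d₂]
  smul_mem' := by
    rintro k ⟨f, h⟩ ⟨g, hg, hf, hh⟩
    refine ⟨k • g, fun a b => (hg a b).const_smul k, (Lp.coeFn_smul _ _).trans (hf.const_smul k), ?_⟩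
    filter_upwards [Lp.coeFn_smul k h, hh,
      (weight_ac_volume c).ae_le hg.ae_differentiableAt] with t e e₁ d
    change (k • h : Hc c) t = _
    rw [e, Pi.smul_apply, e₁, deriv_const_smul k d]

theorem shiftGraph_functional (c : ℝ) (p : Hc c × Hc c) (hp : p ∈ shiftGraph c) (h0 : p.1 = 0) :
    p.2 = 0 := by
  obtain ⟨g, hg, hf, hh⟩ := hp
  have hg0 : g = fun _ => 0 := by
    refine (hg.continuous.ae_eq_iff_eq (μ := (volume : Measure ℝ)) continuous_const).1 ?_
    refine (volume_ac_weight c).ae_le ?_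
    rw [h0] at hf
    exact hf.symm.trans (Lp.coeFn_zero _ _ _)
  rw [Lp.eq_zero_iff_ae_eq_zero]
  refine hh.trans ?_
  rw [hg0]
  filter_upwards with t
  simp

/-- The infinitesimal shift `f ↦ f'` on `L²(ℝ, e^{-2ct} dt)`, with domain the set of those `f` that
are locally absolutely continuous with `f'` again in the space. -/
def infinitesimalShift (c : ℝ) : Hc c →ₗ.[ℂ] Hc c := (shiftGraph c).toLinearPMap

theorem mem_infinitesimalShift_graph (c : ℝ) (f h : Hc c) :
    (f, h) ∈ (infinitesimalShift c).graph ↔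
      ∃ g : ℝ → ℂ, IsAC g ∧ f =ᵐ[weight c] g ∧ h =ᵐ[weight c] deriv g := by
  rw [infinitesimalShift, Submodule.toLinearPMap_graph_eq _ (shiftGraph_functional c)]
  rfl

/-- The spectral operator `ζ(∂_c)`. -/
def spectralOperator (c : ℝ) : Hc c →ₗ.[ℂ] Hc c :=
  functionalCalculus (infinitesimalShift c) riemannZeta

/-- The vertical line `Re s = c`, without the pole of `ζ` (which lies on it only for `c = 1`). -/
def verticalLine (c : ℝ) : Set ℂ := {s | s.re = c ∧ s ≠ 1}

end SpectralOp

end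

open MeasureTheory

noncomputable section

namespace SpectralOp

/-! ### Multiplication operators transported along a unitary map, and their spectral projections -/

section Multiplication

variable {X : Type*} [MeasurableSpace X] {μ : Measure X}
variable {H : Type*} [NormedAddCommGroup H] [InnerProductSpace ℂ H]

/-! Multiplication by `e^{-ct}` followed by the Fourier transform is a unitary map onto `L²(ℝ)` that
turns the shift into multiplication by `symbol c ξ = c + 2πiξ` (`infinitesimalShift_eq_mulOp`).
Hence `ζ(∂_c)` is multiplication by `ζ ∘ symbol c`. A multiplication operator is invertible exactly
when its multiplier is essentially bounded below (`isInvertible_mulOp_iff`). Since `ζ` is continuous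
off `1` and `symbol c` parametrizes the line, this says that `0` is not in the closure of the values
(`exists_ae_le_norm_iff`).

The operator `ζ(∂_c)` is chosen from the existence of some resolution of the identity, so uniqueness
has to be proved (`IsFunctionOf.eq_mulOp`). Let `E` represent multiplication by `z`. On the range of
`E(t)`, with `t` in a ball of radius `r` about `a`, the operator minus `a` has norm at most `2r`;
iterating it shows that vectors in this range vanish wherever `|z - a| ≥ R > 2r`
(`indProj_eq_zero_of_far`). Cutting a closed set into small pieces gives `E(F) ≤ E₀(F)` for the
standard resolution `E₀`. Equal total masses turn this into equality of the scalar measures, which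
determine both domain and quadratic form. -/

theorem mul_coeFn_add (V : H ≃ₗᵢ[ℂ] Lp ℂ 2 μ) (m : X → ℂ) (x y : H) :
    (fun t => m t * V (x + y) t) =ᵐ[μ] (fun t => m t * V x t) + fun t => m t * V y t := by
  rw [map_add]
  filter_upwards [Lp.coeFn_add (V x) (V y)] with t ht
  rw [ht, Pi.add_apply, Pi.add_apply, mul_add]

theorem mul_coeFn_smul (V : H ≃ₗᵢ[ℂ] Lp ℂ 2 μ) (m : X → ℂ) (a : ℂ) (x : H) :
    (fun t => m t * V (a • x) t) =ᵐ[μ] a • fun t => m t * V x t := by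
  rw [map_smul]
  filter_upwards [Lp.coeFn_smul a (V x)] with t ht
  rw [ht, Pi.smul_apply, Pi.smul_apply, smul_eq_mul, smul_eq_mul, mul_left_comm]

/-- The vectors `x` for which the product of `m` and `V x` is square-integrable. -/
def mulDomain (V : H ≃ₗᵢ[ℂ] Lp ℂ 2 μ) (m : X → ℂ) : Submodule ℂ H where
  carrier := {x | MemLp (fun t => m t * V x t) 2 μ}
  zero_mem' := by
    refine (memLp_congr_ae ?_).2 (MemLp.zero' (ε := ℂ))
    have h := mul_coeFn_smul V m 0 0
    rwa [zero_smul, zero_smul] at h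
  add_mem' := fun {x y} hx hy => (memLp_congr_ae (mul_coeFn_add V m x y)).2 (MemLp.add hx hy)
  smul_mem' := fun a x hx => (memLp_congr_ae (mul_coeFn_smul V m a x)).2 (MemLp.const_smul hx a)

theorem mem_mulDomain {V : H ≃ₗᵢ[ℂ] Lp ℂ 2 μ} {m : X → ℂ} {x : H} :
    x ∈ mulDomain V m ↔ MemLp (fun t => m t * V x t) 2 μ := Iff.rfl

/-- The maximal operator of multiplication by `m`, transported to `H` along the unitary map `V`. -/
def mulOp (V : H ≃ₗᵢ[ℂ] Lp ℂ 2 μ) (m : X → ℂ) : H →ₗ.[ℂ] H where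
  domain := mulDomain V m
  toFun :=
    { toFun := fun x => V.symm (MemLp.toLp _ (mem_mulDomain.1 x.2))
      map_add' := fun x y => by
        rw [← map_add, ← MemLp.toLp_add]
        exact congrArg _ (MemLp.toLp_congr _ _ (mul_coeFn_add V m x y))
      map_smul' := fun a x => by
        rw [RingHom.id_apply, ← map_smul, ← MemLp.toLp_const_smul]
        exact congrArg _ (MemLp.toLp_congr _ _ (mul_coeFn_smul V m a x)) }

theorem mem_mulOp_domain {V : H ≃ₗᵢ[ℂ] Lp ℂ 2 μ} {m : X → ℂ} {x : H} :
    x ∈ (mulOp V m).domain ↔ MemLp (fun t => m t * V x t) 2 μ := Iff.rfl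

theorem coeFn_mulOp (V : H ≃ₗᵢ[ℂ] Lp ℂ 2 μ) (m : X → ℂ) (x : (mulOp V m).domain) :
    V (mulOp V m x) =ᵐ[μ] fun t => m t * V x t := by
  have : V (mulOp V m x) = MemLp.toLp _ x.2 := V.apply_symm_apply _
  rw [this]
  exact MemLp.coeFn_toLp _

theorem ext_of_ae (V : H ≃ₗᵢ[ℂ] Lp ℂ 2 μ) {x y : H} (h : V x =ᵐ[μ] V y) : x = y :=
  V.injective (Lp.ext h)

/-- If `V y` is the product of `m` and `V x`, then `x` is in the domain of multiplication by `m`. -/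
theorem mem_mulOp_domain_of_ae {V : H ≃ₗᵢ[ℂ] Lp ℂ 2 μ} {m : X → ℂ} {x y : H}
    (h : V y =ᵐ[μ] fun t => m t * V x t) : x ∈ (mulOp V m).domain :=
  (memLp_congr_ae h).1 (Lp.memLp _)

theorem mulOp_eq_of_ae {V : H ≃ₗᵢ[ℂ] Lp ℂ 2 μ} {m : X → ℂ} {x : (mulOp V m).domain} {y : H}
    (h : V y =ᵐ[μ] fun t => m t * V x t) : mulOp V m x = y :=
  ext_of_ae V ((coeFn_mulOp V m x).trans h.symm)

/-- Multiplication by an essentially bounded function as a bounded operator. -/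
def mulCLM (V : H ≃ₗᵢ[ℂ] Lp ℂ 2 μ) (m : X → ℂ) (hm : AEStronglyMeasurable m μ) (C : ℝ)
    (hC : ∀ᵐ t ∂μ, ‖m t‖ ≤ C) : H →L[ℂ] H :=
  have hdom : ∀ x, x ∈ (mulOp V m).domain := fun x =>
    (Lp.memLp (V x)).of_le_mul (c := C) (hm.mul (Lp.aestronglyMeasurable _)) <| by
      filter_upwards [hC] with t ht
      rw [norm_mul]
      exact mul_le_mul_of_nonneg_right ht (norm_nonneg _)
  LinearMap.mkContinuous
    { toFun := fun x => mulOp V m ⟨x, hdom x⟩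
      map_add' := fun x y => (mulOp V m).map_add ⟨x, hdom x⟩ ⟨y, hdom y⟩
      map_smul' := fun a x => (mulOp V m).map_smul a ⟨x, hdom x⟩ } C <| by
    intro x
    rw [← V.norm_map, ← V.norm_map x]
    refine Lp.norm_le_mul_norm_of_ae_le_mul ?_
    filter_upwards [hC, coeFn_mulOp V m ⟨x, hdom x⟩] with t ht ht'
    change ‖V (mulOp V m ⟨x, hdom x⟩) t‖ ≤ _
    rw [ht', norm_mul]
    exact mul_le_mul_of_nonneg_right ht (norm_nonneg _)

theorem coeFn_mulCLM (V : H ≃ₗᵢ[ℂ] Lp ℂ 2 μ) (m : X → ℂ) (hm : AEStronglyMeasurable m μ) (C : ℝ)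
    (hC : ∀ᵐ t ∂μ, ‖m t‖ ≤ C) (x : H) : V (mulCLM V m hm C hC x) =ᵐ[μ] fun t => m t * V x t :=
  coeFn_mulOp V m ⟨x, _⟩

open Classical in
/-- Multiplication by the indicator function of a set (which is `0` for non-measurable sets). -/
def indProj (V : H ≃ₗᵢ[ℂ] Lp ℂ 2 μ) (s : Set X) : H →L[ℂ] H :=
  if hs : MeasurableSet s then
    mulCLM V (s.indicator 1) ((measurable_one.indicator hs).aestronglyMeasurable) 1
      (Filter.Eventually.of_forall fun t => by by_cases h : t ∈ s <;> simp [h])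
  else 0

theorem coeFn_indProj (V : H ≃ₗᵢ[ℂ] Lp ℂ 2 μ) {s : Set X} (hs : MeasurableSet s) (x : H) :
    V (indProj V s x) =ᵐ[μ] s.indicator (V x) := by
  rw [indProj, dif_pos hs]
  filter_upwards [coeFn_mulCLM V (s.indicator 1)
    ((measurable_one.indicator hs).aestronglyMeasurable) 1
    (Filter.Eventually.of_forall fun t => by by_cases h : t ∈ s <;> simp [h]) x] with t ht
  rw [ht]
  by_cases h : t ∈ s <;> simp [h]

/-- The measure `|V x|² dμ`. -/
def density (V : H ≃ₗᵢ[ℂ] Lp ℂ 2 μ) (x : H) : Measure X :=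
  μ.withDensity fun t => ‖V x t‖ₑ ^ 2

theorem indProj_indProj (V : H ≃ₗᵢ[ℂ] Lp ℂ 2 μ) {s t : Set X} (hs : MeasurableSet s)
    (ht : MeasurableSet t) (x : H) :
    indProj V s (indProj V t x) = indProj V (s ∩ t) x := by
  classical
  refine ext_of_ae V ?_
  filter_upwards [coeFn_indProj V hs (indProj V t x), coeFn_indProj V ht x,
    coeFn_indProj V (hs.inter ht) x] with a h1 h2 h3
  rw [h1, h3, Set.indicator_apply, Set.indicator_apply, h2, Set.indicator_apply]
  by_cases h : a ∈ s <;> by_cases h' : a ∈ t <;> simp [h, h']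

theorem inner_indProj_left (V : H ≃ₗᵢ[ℂ] Lp ℂ 2 μ) {s : Set X}
    (hs : MeasurableSet s) (x y : H) :
    inner ℂ (indProj V s x) y = inner ℂ x (indProj V s y) := by
  rw [← V.inner_map_map, ← V.inner_map_map x, L2.inner_def, L2.inner_def]
  refine integral_congr_ae ?_
  filter_upwards [coeFn_indProj V hs x, coeFn_indProj V hs y] with t h1 h2
  rw [h1, h2]
  by_cases h : t ∈ s <;> simp [h]

theorem isStarProjection_indProj [CompleteSpace H] (V : H ≃ₗᵢ[ℂ] Lp ℂ 2 μ) {s : Set X}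
    (hs : MeasurableSet s) : IsStarProjection (indProj V s) where
  isIdempotentElem := by
    ext x
    simpa using indProj_indProj V hs hs x
  isSelfAdjoint := by
    rw [ContinuousLinearMap.isSelfAdjoint_iff_isSymmetric]
    exact fun x y => inner_indProj_left V hs x y

theorem density_apply (V : H ≃ₗᵢ[ℂ] Lp ℂ 2 μ) (x : H) {s : Set X} (hs : MeasurableSet s) :
    density V x s = ENNReal.ofReal (‖indProj V s x‖ ^ 2) := by
  rw [density, withDensity_apply _ hs, ← V.norm_map, ENNReal.ofReal_pow (norm_nonneg _),
    ofReal_norm, Lp.enorm_def, eLpNorm_congr_ae (coeFn_indProj V hs x),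
    eLpNorm_indicator_eq_eLpNorm_restrict hs,
    eLpNorm_eq_lintegral_rpow_enorm_toReal (by simp) (by simp)]
  simp only [ENNReal.toReal_ofNat, ENNReal.rpow_ofNat, one_div]
  rw [← ENNReal.rpow_natCast, ← ENNReal.rpow_mul]
  simp

instance isFiniteMeasure_density (V : H ≃ₗᵢ[ℂ] Lp ℂ 2 μ) (x : H) :
    IsFiniteMeasure (density V x) := ⟨by
  rw [density_apply V x MeasurableSet.univ]
  exact ENNReal.ofReal_lt_top⟩

theorem norm_indProj_sq (V : H ≃ₗᵢ[ℂ] Lp ℂ 2 μ) (x : H) {s : Set X} (hs : MeasurableSet s) :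
    ‖indProj V s x‖ ^ 2 = (density V x).real s := by
  rw [measureReal_def, density_apply V x hs, ENNReal.toReal_ofReal (sq_nonneg _)]

theorem indProj_univ (V : H ≃ₗᵢ[ℂ] Lp ℂ 2 μ) (x : H) : indProj V Set.univ x = x := by
  refine ext_of_ae V ?_
  simpa using coeFn_indProj V MeasurableSet.univ x

theorem indProj_union (V : H ≃ₗᵢ[ℂ] Lp ℂ 2 μ) {s t : Set X} (hs : MeasurableSet s)
    (ht : MeasurableSet t) (hd : Disjoint s t) (x : H) :
    indProj V (s ∪ t) x = indProj V s x + indProj V t x := by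
  refine ext_of_ae V ?_
  rw [map_add]
  filter_upwards [coeFn_indProj V hs x, coeFn_indProj V ht x, coeFn_indProj V (hs.union ht) x,
    Lp.coeFn_add (V (indProj V s x)) (V (indProj V t x))] with a h1 h2 h3 h4
  rw [h4, h3, Pi.add_apply, h1, h2, Set.indicator_union_of_disjoint hd]

theorem indProj_empty (V : H ≃ₗᵢ[ℂ] Lp ℂ 2 μ) (x : H) : indProj V ∅ x = 0 := by
  have := norm_indProj_sq V x MeasurableSet.empty
  simpa using this

/-- The squared norm of the remainder is the mass that the finite measure `density V x` gives to the
sets not yet summed, so countable additivity of this measure suffices. -/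
theorem hasSum_indProj (V : H ≃ₗᵢ[ℂ] Lp ℂ 2 μ) {s : ℕ → Set X} (hs : ∀ n, MeasurableSet (s n))
    (hd : Pairwise (Function.onFun Disjoint s)) (x : H) :
    HasSum (fun n => indProj V (s n) x) (indProj V (⋃ n, s n) x) := by
  have hfin : ∀ F : Finset ℕ, MeasurableSet (⋃ n ∈ F, s n) := fun F =>
    F.measurableSet_biUnion fun n _ => hs n
  have hsum : ∀ F : Finset ℕ, ∑ n ∈ F, indProj V (s n) x = indProj V (⋃ n ∈ F, s n) x := by
    intro F
    induction F using Finset.induction_on with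
    | empty => simp [indProj_empty]
    | insert a F ha ih =>
      rw [Finset.sum_insert ha, ih, Finset.set_biUnion_insert, indProj_union V (hs a) (hfin F)]
      rw [Set.disjoint_iUnion₂_right]
      exact fun n hn => hd (by rintro rfl; exact ha hn)
  have hU : MeasurableSet (⋃ n, s n) := MeasurableSet.iUnion hs
  have hdiff : ∀ F : Finset ℕ,
      ‖∑ n ∈ F, indProj V (s n) x - indProj V (⋃ n, s n) x‖ ^ 2 =
        (density V x).real (⋃ n, s n) - ∑ n ∈ F, (density V x).real (s n) := by
    intro F
    have hsub : (⋃ n ∈ F, s n) ⊆ ⋃ n, s n := Set.iUnion₂_subset fun n _ => Set.subset_iUnion s n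
    have h1 : indProj V (⋃ n, s n) x =
        indProj V (⋃ n ∈ F, s n) x + indProj V ((⋃ n, s n) \ ⋃ n ∈ F, s n) x := by
      rw [← indProj_union V (hfin F) (hU.diff (hfin F)) Set.disjoint_sdiff_right,
        Set.union_sdiff_cancel hsub]
    rw [hsum, h1, sub_add_cancel_left, norm_neg, norm_indProj_sq V x (hU.diff (hfin F)),
      measureReal_sdiff hsub (hfin F), measureReal_biUnion_finset (fun i _ j _ hij => hd hij)
        (fun n _ => hs n)]
  have hm : HasSum (fun n => (density V x).real (s n)) ((density V x).real (⋃ n, s n)) := by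
    have h2 := measure_iUnion (μ := density V x) hd hs
    simp only [measureReal_def]
    rw [h2, ENNReal.tsum_toReal_eq fun n => measure_ne_top _ _]
    exact ENNReal.hasSum_toReal (by rw [← h2]; exact measure_ne_top _ _)
  rw [HasSum, tendsto_iff_norm_sub_tendsto_zero]
  have h3 : Filter.Tendsto (fun F : Finset ℕ => ‖∑ n ∈ F, indProj V (s n) x
      - indProj V (⋃ n, s n) x‖ ^ 2) (SummationFilter.unconditional ℕ).filter (nhds 0) := by
    simp only [hdiff]
    simpa using (tendsto_const_nhds (x := (density V x).real (⋃ n, s n))).sub hm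
  have h4 := h3.sqrt
  simpa using h4

/-- The resolution of the identity of the operator of multiplication by `z`. -/
def mulResolution [CompleteSpace H] (V : H ≃ₗᵢ[ℂ] Lp ℂ 2 μ) (z : X → ℂ) (hz : Measurable z) :
    ResolutionOfIdentity H := by
  classical exact
  -- The test on `s` is needed besides the one in `indProj`: a non-measurable set can have a
  -- measurable preimage.
  { proj := fun s => if MeasurableSet s then indProj V (z ⁻¹' s) else 0
    isStarProjection := fun s hs => by
      rw [if_pos hs]
      exact isStarProjection_indProj V (hz hs)
    proj_of_not_measurable := fun s hs => if_neg hs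
    proj_univ := by
      rw [if_pos MeasurableSet.univ]
      ext x
      exact indProj_univ V x
    proj_inter := fun s t hs ht => by
      rw [if_pos hs, if_pos ht, if_pos (hs.inter ht)]
      ext x
      exact (indProj_indProj V (hz hs) (hz ht) x).symm
    hasSum_iUnion := fun s hs hd x => by
      rw [if_pos (MeasurableSet.iUnion hs), Set.preimage_iUnion]
      simp only [if_pos (hs _)]
      exact hasSum_indProj V (fun n => hz (hs n)) (fun i j hij => (hd hij).preimage z) x }

theorem mulResolution_proj [CompleteSpace H] (V : H ≃ₗᵢ[ℂ] Lp ℂ 2 μ) (z : X → ℂ)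
    (hz : Measurable z) {s : Set ℂ} (hs : MeasurableSet s) :
    (mulResolution V z hz).proj s = indProj V (z ⁻¹' s) := if_pos hs

end Multiplication

/-! ### Scalar spectral measures of a resolution of the identity -/

namespace ResolutionOfIdentity

variable {H : Type*} [NormedAddCommGroup H] [InnerProductSpace ℂ H] [CompleteSpace H]
  (E : ResolutionOfIdentity H)

theorem proj_proj {s t : Set ℂ} (hs : MeasurableSet s) (ht : MeasurableSet t) (x : H) :
    E.proj s (E.proj t x) = E.proj (s ∩ t) x := by
  rw [E.proj_inter s t hs ht]
  rfl

theorem inner_proj_left {s : Set ℂ} (hs : MeasurableSet s) (x y : H) :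
    inner ℂ (E.proj s x) y = inner ℂ x (E.proj s y) :=
  ContinuousLinearMap.isSelfAdjoint_iff_isSymmetric.1 (E.isStarProjection s hs).isSelfAdjoint x y

theorem scalarMeasure_apply (x : H) {s : Set ℂ} (hs : MeasurableSet s) :
    E.scalarMeasure x s = ENNReal.ofReal (‖E.proj s x‖ ^ 2) := by
  have : (inner ℂ x (E.proj s x)).re = ‖E.proj s x‖ ^ 2 := by
    have h := E.proj_proj hs hs x
    rw [Set.inter_self] at h
    rw [← h, ← E.inner_proj_left hs, h]
    exact inner_self_eq_norm_sq (𝕜 := ℂ) _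
  rw [← this]
  exact Measure.ofMeasurable_apply s hs

theorem scalarMeasure_univ (x : H) :
    E.scalarMeasure x Set.univ = ENNReal.ofReal (‖x‖ ^ 2) := by
  rw [E.scalarMeasure_apply x MeasurableSet.univ, E.proj_univ]
  rfl

instance isFiniteMeasure_scalarMeasure (x : H) : IsFiniteMeasure (E.scalarMeasure x) := ⟨by
  rw [E.scalarMeasure_univ]
  exact ENNReal.ofReal_lt_top⟩

theorem scalarMeasure_proj (x : H) {t : Set ℂ} (ht : MeasurableSet t) :
    E.scalarMeasure (E.proj t x) = (E.scalarMeasure x).restrict t := by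
  ext s hs
  rw [Measure.restrict_apply hs, E.scalarMeasure_apply _ hs, E.scalarMeasure_apply _ (hs.inter ht),
    E.proj_proj hs ht]

theorem proj_compl (x : H) {t : Set ℂ} (ht : MeasurableSet t) :
    E.proj tᶜ x = x - E.proj t x := by
  -- Finite additivity comes from countable additivity for the sequence `t, tᶜ, ∅, ∅, …`.
  have h := E.hasSum_iUnion (fun n => if n = 0 then t else if n = 1 then tᶜ else ∅)
    (fun n => by split_ifs <;> measurability) ?_ x
  · have h2 : HasSum (fun n : ℕ => E.proj (if n = 0 then t else if n = 1 then tᶜ else ∅) x)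
        (∑ n ∈ Finset.range 2, E.proj (if n = 0 then t else if n = 1 then tᶜ else ∅) x) := by
      refine hasSum_sum_of_ne_finset_zero fun n hn => ?_
      rw [Finset.mem_range] at hn
      rw [if_neg (by omega), if_neg (by omega), E.proj_empty]
    have h3 : (⋃ n : ℕ, if n = 0 then t else if n = 1 then tᶜ else ∅) = Set.univ := by
      refine Set.eq_univ_of_forall fun z => Set.mem_iUnion.2 ?_
      by_cases hz : z ∈ t
      · exact ⟨0, by simpa using hz⟩
      · exact ⟨1, by simpa using hz⟩
    rw [h3, E.proj_univ] at h
    have h4 := h.unique h2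
    simp [Finset.sum_range_succ] at h4
    rw [eq_sub_iff_add_eq, add_comm]
    exact h4.symm
  · intro i j hij
    simp only [Function.onFun]
    rcases i with _ | _ | i <;> rcases j with _ | _ | j <;>
      simp_all [disjoint_compl_left, disjoint_compl_right]

/-- The scalar spectral measures are additive on orthogonal spectral subspaces. -/
theorem scalarMeasure_add {t : Set ℂ} (ht : MeasurableSet t) {x y : H} (hx : E.proj t x = x)
    (hy : E.proj t y = 0) :
    E.scalarMeasure (x + y) = E.scalarMeasure x + E.scalarMeasure y := by
  ext s hs
  rw [Measure.add_apply, E.scalarMeasure_apply _ hs, E.scalarMeasure_apply _ hs,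
    E.scalarMeasure_apply _ hs, ← ENNReal.ofReal_add (sq_nonneg _) (sq_nonneg _)]
  congr 1
  have h0 : inner ℂ (E.proj s x) (E.proj s y) = 0 := by
    rw [← hx, E.proj_proj hs ht, Set.inter_comm, ← E.proj_proj ht hs, E.inner_proj_left ht,
      E.proj_proj ht hs, Set.inter_comm, ← E.proj_proj hs ht, hy, map_zero, inner_zero_right]
  rw [map_add, sq, sq, sq]
  exact norm_add_sq_eq_norm_sq_add_norm_sq_of_inner_eq_zero _ _ h0

end ResolutionOfIdentity

/-! ### Operators controlled by their quadratic forms -/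

section Polarization

variable {H : Type*} [NormedAddCommGroup H] [InnerProductSpace ℂ H]

/-- A bound for the quadratic form of an operator bounds its sesquilinear form. -/
theorem norm_inner_le_of_quadratic {D : Submodule ℂ H} (T : D →ₗ[ℂ] H) {r : ℝ}
    (h : ∀ x : D, ‖inner ℂ (x : H) (T x)‖ ≤ r * ‖(x : H)‖ ^ 2) (x y : D) :
    ‖inner ℂ (y : H) (T x)‖ ≤ r * (‖(x : H)‖ ^ 2 + ‖(y : H)‖ ^ 2) := by
  -- Polarization; the parallelogram law then evaluates the sum of the four quadratic bounds.
  have key : 4 * inner ℂ (y : H) (T x) =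
      (inner ℂ ((x + y : D) : H) (T (x + y)) - inner ℂ ((x - y : D) : H) (T (x - y))) +
      Complex.I * (inner ℂ ((x + Complex.I • y : D) : H) (T (x + Complex.I • y)) -
        inner ℂ ((x - Complex.I • y : D) : H) (T (x - Complex.I • y))) := by
    simp only [map_add, map_sub, map_smul, Submodule.coe_add, Submodule.coe_sub, Submodule.coe_smul,
      inner_add_left, inner_add_right, inner_sub_left, inner_sub_right, inner_smul_left,
      inner_smul_right, Complex.conj_I]
    ring_nf
    simp only [Complex.I_sq]
    ring
  have hp1 := parallelogram_law_with_norm ℂ (x : H) (y : H)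
  have hp2 := parallelogram_law_with_norm ℂ (x : H) (Complex.I • (y : H))
  have hI : ‖Complex.I • (y : H)‖ = ‖(y : H)‖ := by simp [norm_smul]
  rw [hI] at hp2
  have h1 := h (x + y)
  have h2 := h (x - y)
  have h3 := h (x + Complex.I • y)
  have h4 := h (x - Complex.I • y)
  have h5 : ‖(4 : ℂ) * inner ℂ (y : H) (T x)‖ = 4 * ‖inner ℂ (y : H) (T x)‖ := by simp
  have h6 : ‖(4 : ℂ) * inner ℂ (y : H) (T x)‖ ≤
      (‖inner ℂ ((x + y : D) : H) (T (x + y))‖ + ‖inner ℂ ((x - y : D) : H) (T (x - y))‖) +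
      (‖inner ℂ ((x + Complex.I • y : D) : H) (T (x + Complex.I • y))‖ +
        ‖inner ℂ ((x - Complex.I • y : D) : H) (T (x - Complex.I • y))‖) := by
    rw [key]
    refine (norm_add_le _ _).trans (add_le_add (norm_sub_le _ _) ?_)
    rw [norm_mul, Complex.norm_I, one_mul]
    exact norm_sub_le _ _
  simp only [Submodule.coe_add, Submodule.coe_sub, Submodule.coe_smul] at h1 h2 h3 h4 h6
  have h7 : r * ‖(x : H) + y‖ ^ 2 + r * ‖(x : H) - y‖ ^ 2 + (r * ‖(x : H) + Complex.I • y‖ ^ 2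
      + r * ‖(x : H) - Complex.I • y‖ ^ 2) = 4 * (r * (‖(x : H)‖ ^ 2 + ‖(y : H)‖ ^ 2)) := by
    linear_combination r * hp1 + r * hp2
  linarith

/-- The numerical radius bounds the norm up to a factor `2`. -/
theorem norm_le_of_quadratic {D : Submodule ℂ H} (T : D →ₗ[ℂ] H) {r : ℝ}
    (h : ∀ x : D, ‖inner ℂ (x : H) (T x)‖ ≤ r * ‖(x : H)‖ ^ 2) (hT : ∀ x, T x ∈ D) (x : D) :
    ‖T x‖ ≤ 2 * r * ‖(x : H)‖ := by
  rcases eq_or_ne (T x) 0 with h0 | h0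
  · rcases eq_or_ne x 0 with rfl | hx
    · simp
    have hx' : 0 < ‖(x : H)‖ := norm_pos_iff.2 (by simpa using hx)
    have := (norm_nonneg _).trans (h x)
    have hr : 0 ≤ r := nonneg_of_mul_nonneg_left this (by positivity)
    rw [h0, norm_zero]
    positivity
  · have hx : x ≠ 0 := by rintro rfl; simp at h0
    have hx' : 0 < ‖(x : H)‖ := norm_pos_iff.2 (by simpa using hx)
    have hT' : 0 < ‖T x‖ := norm_pos_iff.2 h0
    -- The test vector is `T x` rescaled to the norm of `x`, so the right side becomes `2r‖x‖²` and
    -- the left side `‖x‖‖T x‖`. Invariance of `D` puts it in the domain.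
    have key := norm_inner_le_of_quadratic T h x (((‖(x : H)‖ / ‖T x‖ : ℝ) : ℂ) • ⟨T x, hT x⟩)
    rw [Submodule.coe_smul, inner_smul_left, norm_mul, norm_smul] at key
    simp only [inner_self_eq_norm_sq_to_K, Complex.conj_ofReal, Complex.norm_real, norm_div,
      norm_norm, norm_pow, Complex.coe_algebraMap] at key
    have e1 : ‖(x : H)‖ / ‖T x‖ * ‖T x‖ ^ 2 = ‖(x : H)‖ * ‖T x‖ := by field_simp
    have e2 : ‖(x : H)‖ / ‖T x‖ * ‖T x‖ = ‖(x : H)‖ := by field_simp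
    rw [e1, e2] at key
    have : ‖(x : H)‖ * ‖T x‖ ≤ ‖(x : H)‖ * (2 * r * ‖(x : H)‖) := by linarith
    exact le_of_mul_le_mul_left this hx'

/-- The case `r = 0` of the polarization bound makes every value of `A - B` orthogonal to the dense
domain. This is why `IsIntegral`, which prescribes only quadratic forms, determines the operator
once its domain is dense. -/
theorem linearPMap_ext_of_quadratic {A B : H →ₗ.[ℂ] H} (hd : Dense (A.domain : Set H))
    (hdom : ∀ x, x ∈ A.domain ↔ x ∈ B.domain)
    (hq : ∀ (x : H) (hx : x ∈ A.domain) (hx' : x ∈ B.domain),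
      inner ℂ x (A ⟨x, hx⟩) = inner ℂ x (B ⟨x, hx'⟩)) : A = B := by
  have hle : A.domain ≤ B.domain := fun x hx => (hdom x).1 hx
  have h0 := norm_inner_le_of_quadratic (A.toFun - B.toFun ∘ₗ Submodule.inclusion hle) (r := 0) (by
    intro x
    rw [zero_mul, LinearMap.sub_apply, inner_sub_right, norm_le_zero_iff, sub_eq_zero]
    exact hq x x.2 (hle x.2))
  refine LinearPMap.ext (Submodule.ext hdom) fun x hx hx' => ?_
  rw [← sub_eq_zero]
  refine hd.eq_zero_of_inner_right ℂ fun y hy => ?_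
  have := h0 ⟨x, hx⟩ ⟨y, hy⟩
  rw [zero_mul, norm_le_zero_iff] at this
  exact this

end Polarization

/-! ### The standard resolution of the identity and integrals against it -/

section Multiplication

variable {X : Type*} [MeasurableSpace X] {μ : Measure X}
variable {H : Type*} [NormedAddCommGroup H] [InnerProductSpace ℂ H]

theorem scalarMeasure_mulResolution [CompleteSpace H] (V : H ≃ₗᵢ[ℂ] Lp ℂ 2 μ) {z : X → ℂ}
    (hz : Measurable z) (x : H) : (mulResolution V z hz).scalarMeasure x = (density V x).map z := by
  ext s hs
  rw [ResolutionOfIdentity.scalarMeasure_apply _ _ hs, Measure.map_apply hz hs,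
    density_apply V x (hz hs), mulResolution_proj V z hz hs]

theorem memLp_density_iff (V : H ≃ₗᵢ[ℂ] Lp ℂ 2 μ) {m : X → ℂ} (hm : Measurable m) (x : H) :
    MemLp m 2 (density V x) ↔ MemLp (fun t => m t * V x t) 2 μ := by
  have hV := Lp.aestronglyMeasurable (V x)
  have h1 : ∫⁻ t, ‖m t‖ₑ ^ (2 : ℝ) ∂(density V x) = ∫⁻ t, ‖m t * V x t‖ₑ ^ (2 : ℝ) ∂μ := by
    rw [density, lintegral_withDensity_eq_lintegral_mul₀ (hV.enorm.pow_const 2)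
      (hm.enorm.pow_const _).aemeasurable]
    refine lintegral_congr fun t => ?_
    simp [enorm_mul, mul_pow, mul_comm]
  have h2 : AEStronglyMeasurable (fun t => m t * V x t) μ := hm.aestronglyMeasurable.mul hV
  rw [MemLp, MemLp, eLpNorm_lt_top_iff_lintegral_rpow_enorm_lt_top (by simp) (by simp),
    eLpNorm_lt_top_iff_lintegral_rpow_enorm_lt_top (by simp) (by simp)]
  simp only [ENNReal.toReal_ofNat, h1, h2, hm.aestronglyMeasurable, true_and]

theorem integral_density (V : H ≃ₗᵢ[ℂ] Lp ℂ 2 μ) (m : X → ℂ) (x : H) :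
    ∫ t, m t ∂(density V x) = ∫ t, m t * (‖V x t‖ ^ 2 : ℝ) ∂μ := by
  have hV := Lp.aestronglyMeasurable (V x)
  rw [density, integral_withDensity_eq_integral_toReal_smul₀ (hV.enorm.pow_const 2)
    (by filter_upwards with t; simp)]
  refine integral_congr_ae ?_
  filter_upwards with t
  simp [mul_comm]

theorem isIntegral_mulResolution [CompleteSpace H] (V : H ≃ₗᵢ[ℂ] Lp ℂ 2 μ) {z : X → ℂ}
    (hz : Measurable z) {φ : ℂ → ℂ} (hφ : Measurable φ) :
    (mulResolution V z hz).IsIntegral φ (mulOp V (φ ∘ z)) := by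
  constructor
  · intro x
    rw [scalarMeasure_mulResolution, memLp_map_measure_iff hφ.aestronglyMeasurable hz.aemeasurable,
      memLp_density_iff V (hφ.comp hz), mem_mulOp_domain]
  · intro x
    rw [scalarMeasure_mulResolution, integral_map hz.aemeasurable hφ.aestronglyMeasurable,
      integral_density, ← V.inner_map_map, L2.inner_def]
    refine integral_congr_ae ?_
    filter_upwards [coeFn_mulOp V (φ ∘ z) x] with t ht
    rw [ht, RCLike.inner_apply, Function.comp_apply, mul_assoc, Complex.mul_conj,
      Complex.normSq_eq_norm_sq]

/-- Cutting a vector along the sets where `⌊‖m‖⌋₊ = n` writes it as a convergent sum of vectors on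
whose supports `m` is bounded. -/
theorem dense_mulOp_domain (V : H ≃ₗᵢ[ℂ] Lp ℂ 2 μ) {m : X → ℂ} (hm : Measurable m) :
    Dense ((mulOp V m).domain : Set H) := by
  intro x
  let s : ℕ → Set X := fun n => {t | ⌊‖m t‖⌋₊ = n}
  have hs : ∀ n, MeasurableSet (s n) := fun n =>
    (Nat.measurable_floor.comp hm.norm) (measurableSet_singleton n)
  have hd : Pairwise (Function.onFun Disjoint s) := fun i j hij =>
    Set.disjoint_left.2 fun t hi hj => hij (hi.symm.trans hj)
  have hU : (⋃ n, s n) = Set.univ := Set.eq_univ_of_forall fun t => Set.mem_iUnion.2 ⟨_, rfl⟩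
  have h := hasSum_indProj V hs hd x
  rw [hU, indProj_univ] at h
  refine mem_closure_of_tendsto h (Filter.Eventually.of_forall fun F => ?_)
  refine Submodule.sum_mem _ fun n _ => ?_
  rw [mem_mulOp_domain]
  refine (Lp.memLp (V (indProj V (s n) x))).of_le_mul (c := n + 1)
    (hm.aestronglyMeasurable.mul (Lp.aestronglyMeasurable _)) ?_
  filter_upwards [coeFn_indProj V (hs n) x] with t ht
  rw [norm_mul, ht]
  by_cases htn : t ∈ s n
  · refine mul_le_mul_of_nonneg_right ?_ (norm_nonneg _)
    have htn' : ⌊‖m t‖⌋₊ = n := htn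
    rw [← htn']
    exact (Nat.lt_floor_add_one _).le
  · simp [htn]

end Multiplication

/-! ### The operator `∫ w dE` on spectral subspaces -/

namespace ResolutionOfIdentity

variable {H : Type*} [NormedAddCommGroup H] [InnerProductSpace ℂ H] [CompleteSpace H]
  {E : ResolutionOfIdentity H}

theorem IsIntegral.proj_mem_domain {φ : ℂ → ℂ} {A : H →ₗ.[ℂ] H} (hA : E.IsIntegral φ A)
    {t : Set ℂ} (ht : MeasurableSet t) {x : H} (hx : x ∈ A.domain) : E.proj t x ∈ A.domain := by
  rw [hA.1, E.scalarMeasure_proj x ht]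
  exact ((hA.1 x).1 hx).restrict t

/-- The scalar measure of `x + y` is the sum of those of `x` and `y`, so the quadratic form is
additive and its cross terms cancel. -/
theorem IsIntegral.inner_add_inner_eq_zero {φ : ℂ → ℂ} {A : H →ₗ.[ℂ] H} (hA : E.IsIntegral φ A)
    {t : Set ℂ} (ht : MeasurableSet t) {x y : A.domain} (hx : E.proj t x = x)
    (hy : E.proj t y = 0) : inner ℂ (x : H) (A y) + inner ℂ (y : H) (A x) = 0 := by
  have h1 := hA.2 (x + y)
  rw [Submodule.coe_add, E.scalarMeasure_add ht hx hy,
    integral_add_measure (((hA.1 x).1 x.2).integrable one_le_two)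
      (((hA.1 y).1 y.2).integrable one_le_two),
    ← hA.2, ← hA.2, LinearPMap.map_add] at h1
  simp only [inner_add_left, inner_add_right] at h1
  linear_combination h1

/-- A spectral subspace is invariant under `∫ φ dE`. -/
theorem IsIntegral.proj_apply {φ : ℂ → ℂ} {A : H →ₗ.[ℂ] H} (hA : E.IsIntegral φ A)
    (hd : Dense (A.domain : Set H)) {t : Set ℂ} (ht : MeasurableSet t) {x : A.domain}
    (hx : E.proj t x = x) : E.proj t (A x) = A x := by
  have h0 : E.proj tᶜ (A x) = 0 := by
    refine hd.eq_zero_of_inner_right ℂ fun y hy => ?_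
    let y' : A.domain := ⟨E.proj tᶜ y, hA.proj_mem_domain ht.compl hy⟩
    have hy' : E.proj t (y' : H) = 0 := by
      rw [E.proj_proj ht ht.compl, Set.inter_compl_self, E.proj_empty]
    have h1 := hA.inner_add_inner_eq_zero ht hx hy'
    -- Replacing `y'` by `i y'` flips the relative sign of the two cross terms, so each of them
    -- vanishes.
    have h2 := hA.inner_add_inner_eq_zero ht (y := Complex.I • y') hx
      (by rw [Submodule.coe_smul, map_smul, hy', smul_zero])
    rw [LinearPMap.map_smul, Submodule.coe_smul, inner_smul_left, inner_smul_right,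
      Complex.conj_I] at h2
    rw [← E.inner_proj_left ht.compl]
    change inner ℂ (y' : H) (A x) = 0
    have h3 : 2 * inner ℂ (y' : H) (A x) = 0 := by
      linear_combination h1 + Complex.I * h2 +
        (inner ℂ (y' : H) (A x) - inner ℂ (x : H) (A y')) * Complex.I_sq
    simpa using h3
  rw [E.proj_compl _ ht, sub_eq_zero] at h0
  exact h0.symm

theorem IsIntegral.mem_domain_of_subset {A : H →ₗ.[ℂ] H} (hA : E.IsIntegral (fun w => w) A)
    {t : Set ℂ} (ht : MeasurableSet t) {a : ℂ} {r : ℝ} (htr : t ⊆ Metric.closedBall a r) {x : H}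
    (hx : E.proj t x = x) : x ∈ A.domain := by
  rw [hA.1, ← hx, E.scalarMeasure_proj x ht]
  refine MemLp.of_bound measurable_id.aestronglyMeasurable (‖a‖ + r) ?_
  filter_upwards [ae_restrict_mem ht] with w hw
  have := htr hw
  rw [mem_closedBall_iff_norm] at this
  have h2 := norm_add_le a (w - a)
  rw [add_sub_cancel] at h2
  linarith

theorem IsIntegral.norm_inner_sub_le {A : H →ₗ.[ℂ] H} (hA : E.IsIntegral (fun w => w) A)
    {t : Set ℂ} (ht : MeasurableSet t) {a : ℂ} {r : ℝ} (htr : t ⊆ Metric.closedBall a r)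
    {x : A.domain} (hx : E.proj t x = x) :
    ‖inner ℂ (x : H) (A x - a • (x : H))‖ ≤ r * ‖(x : H)‖ ^ 2 := by
  have hreal : (E.scalarMeasure (x : H)).real Set.univ = ‖(x : H)‖ ^ 2 := by
    rw [measureReal_def, E.scalarMeasure_univ, ENNReal.toReal_ofReal (sq_nonneg _)]
  have h1 : inner ℂ (x : H) (A x - a • (x : H)) = ∫ w, (w - a) ∂(E.scalarMeasure (x : H)) := by
    rw [integral_sub (((hA.1 x).1 x.2).integrable one_le_two) (integrable_const _), ← hA.2,
      inner_sub_right, inner_smul_right, integral_const, hreal, inner_self_eq_norm_sq_to_K]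
    simp [mul_comm]
  rw [h1, ← hreal]
  refine norm_integral_le_of_norm_le_const ?_
  rw [← hx, E.scalarMeasure_proj _ ht]
  filter_upwards [ae_restrict_mem ht] with w hw
  exact mem_closedBall_iff_norm.1 (htr hw)

/-- On the spectral subspace of a set of small diameter, `∫ w dE` is close to a scalar. -/
theorem IsIntegral.norm_sub_le {A : H →ₗ.[ℂ] H} (hA : E.IsIntegral (fun w => w) A)
    (hd : Dense (A.domain : Set H)) {t : Set ℂ} (ht : MeasurableSet t) {a : ℂ} {r : ℝ}
    (htr : t ⊆ Metric.closedBall a r) {x : A.domain} (hx : E.proj t x = x) :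
    ‖A x - a • (x : H)‖ ≤ 2 * r * ‖(x : H)‖ := by
  -- The range of `E(t)`, which `A` maps to itself; the factor `2` in the bound is the loss from
  -- numerical radius to norm.
  let D : Submodule ℂ H := LinearMap.eqLocus (E.proj t : H →ₗ[ℂ] H) LinearMap.id
  have hD : D ≤ A.domain := fun y hy => hA.mem_domain_of_subset ht htr hy
  let T : D →ₗ[ℂ] H := A.toFun ∘ₗ Submodule.inclusion hD - a • D.subtype
  have hT : ∀ y : D, T y = A ⟨y, hD y.2⟩ - a • (y : H) := fun y => rfl
  refine norm_le_of_quadratic T (r := r) (fun y => ?_) (fun y => ?_) ⟨x, hx⟩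
  · rw [hT]
    exact hA.norm_inner_sub_le ht htr (x := ⟨y, hD y.2⟩) y.2
  · rw [hT]
    have h1 := hA.proj_apply hd ht (x := ⟨y, hD y.2⟩) y.2
    have h2 : E.proj t (y : H) = y := y.2
    change E.proj t _ = _
    rw [map_sub, map_smul, h1, h2]
    rfl

end ResolutionOfIdentity

/-! ### Comparison of finite measures on closed sets -/

section Measure

/-- A finite measure that is at most another one of the same total mass on closed sets is equal to
it. -/
theorem measure_eq_of_le_isClosed {Y : Type*} [TopologicalSpace Y]
    [TopologicalSpace.PseudoMetrizableSpace Y] [MeasurableSpace Y] [BorelSpace Y]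
    {ν₁ ν₂ : Measure Y} [IsFiniteMeasure ν₁] [IsFiniteMeasure ν₂]
    (h : ∀ F, IsClosed F → ν₁ F ≤ ν₂ F) (huniv : ν₁ Set.univ = ν₂ Set.univ) : ν₁ = ν₂ := by
  have hle : ∀ s, MeasurableSet s → ν₁ s ≤ ν₂ s := by
    intro s hs
    rw [hs.measure_eq_iSup_isClosed_of_ne_top (measure_ne_top _ _)]
    exact iSup₂_le fun F hF => iSup_le fun hFc => (h F hFc).trans (measure_mono hF)
  ext s hs
  refine le_antisymm (hle s hs) ?_
  -- Applied to the complement, the inequality reverses because the total masses agree.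
  have h1 := hle sᶜ hs.compl
  rw [measure_compl hs (measure_ne_top _ _), measure_compl hs (measure_ne_top _ _), huniv] at h1
  exact (ENNReal.sub_le_sub_iff_left (measure_mono (Set.subset_univ s)) (measure_ne_top _ _)).1 h1

end Measure

/-! ### Uniqueness of the functional calculus for multiplication operators -/

section Uniqueness

variable {X : Type*} [MeasurableSpace X] {μ : Measure X}
variable {H : Type*} [NormedAddCommGroup H] [InnerProductSpace ℂ H]

theorem mul_norm_indProj_le {V : H ≃ₗᵢ[ℂ] Lp ℂ 2 μ} {z : X → ℂ} {s : Set X} (hs : MeasurableSet s)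
    {a : ℂ} {R : ℝ} (hR : 0 ≤ R) (hsR : ∀ t ∈ s, R ≤ ‖z t - a‖) (x : (mulOp V z).domain) :
    R * ‖indProj V s x‖ ≤ ‖indProj V s (mulOp V z x - a • (x : H))‖ := by
  have h1 : R * ‖indProj V s x‖ = ‖(R : ℂ) • V (indProj V s x)‖ := by
    rw [norm_smul, V.norm_map, Complex.norm_real, Real.norm_of_nonneg hR]
  rw [h1, ← V.norm_map (indProj V s (mulOp V z x - a • (x : H)))]
  refine Lp.norm_le_norm_of_ae_le ?_
  have h2 := Lp.coeFn_sub (V (mulOp V z x)) (a • V (x : H))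
  have h3 := Lp.coeFn_smul a (V (x : H))
  rw [← map_smul, ← map_sub] at h2
  rw [← map_smul] at h3
  filter_upwards [coeFn_indProj V hs (x : H), coeFn_indProj V hs (mulOp V z x - a • (x : H)),
    coeFn_mulOp V z x, h2, h3, Lp.coeFn_smul (R : ℂ) (V (indProj V s x))] with t e1 e2 e3 e4 e5 e6
  rw [e6, Pi.smul_apply, e1, e2]
  by_cases ht : t ∈ s
  · rw [Set.indicator_of_mem ht, Set.indicator_of_mem ht, e4, Pi.sub_apply, e3, e5, Pi.smul_apply,
      smul_eq_mul, smul_eq_mul, ← sub_mul, norm_mul, norm_mul, Complex.norm_real,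
      Real.norm_of_nonneg hR]
    exact mul_le_mul_of_nonneg_right (hsR t ht) (norm_nonneg _)
  · simp [ht]

theorem norm_indProj_le (V : H ≃ₗᵢ[ℂ] Lp ℂ 2 μ) {s : Set X} (hs : MeasurableSet s) (x : H) :
    ‖indProj V s x‖ ≤ ‖x‖ := by
  rw [← V.norm_map, ← V.norm_map x]
  refine Lp.norm_le_norm_of_ae_le ?_
  filter_upwards [coeFn_indProj V hs x] with t ht
  rw [ht]
  exact norm_indicator_le_norm_self _ _

variable [CompleteSpace H]

/-- If `E` is a resolution of the identity for multiplication by `z`, then the elements of the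
spectral subspace of a small set are supported where `z` is close to that set. -/
theorem indProj_eq_zero_of_far {V : H ≃ₗᵢ[ℂ] Lp ℂ 2 μ} {z : X → ℂ} (hz : Measurable z)
    {E : ResolutionOfIdentity H} (hE : E.IsIntegral (fun w => w) (mulOp V z)) {t : Set ℂ}
    (ht : MeasurableSet t) {a : ℂ} {r R : ℝ} (hr : 0 ≤ r) (hR : 2 * r < R)
    (htr : t ⊆ Metric.closedBall a r) {s : Set X} (hs : MeasurableSet s)
    (hsR : ∀ y ∈ s, R ≤ ‖z y - a‖) {x : H} (hx : E.proj t x = x) : indProj V s x = 0 := by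
  have hd := dense_mulOp_domain V hz
  have hR0 : 0 < R := by linarith
  -- Multiplication by `z - a` preserves the range of `E(t)`, enlarges norms there by at most `2r`,
  -- and enlarges the part over `s` by at least `R`. As `2r < R`, iteration forces that part to be
  -- zero.
  have key : ∀ (n : ℕ) (x : H), E.proj t x = x → R ^ n * ‖indProj V s x‖ ≤ (2 * r) ^ n * ‖x‖ := by
    intro n
    induction n with
    | zero => intro x _; simpa using norm_indProj_le V hs x
    | succ n ih =>
      intro x hx
      have hxd := hE.mem_domain_of_subset ht htr hx
      have hinv := hE.proj_apply hd ht (x := ⟨x, hxd⟩) hx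
      have h1 := ih (mulOp V z ⟨x, hxd⟩ - a • x) (by rw [map_sub, map_smul, hinv, hx])
      have h2 := mul_norm_indProj_le hs hR0.le hsR ⟨x, hxd⟩
      have h3 := hE.norm_sub_le hd ht htr (x := ⟨x, hxd⟩) hx
      calc R ^ (n + 1) * ‖indProj V s x‖ = R ^ n * (R * ‖indProj V s x‖) := by ring
        _ ≤ R ^ n * ‖indProj V s (mulOp V z ⟨x, hxd⟩ - a • x)‖ := by gcongr
        _ ≤ (2 * r) ^ n * ‖mulOp V z ⟨x, hxd⟩ - a • x‖ := h1
        _ ≤ (2 * r) ^ n * (2 * r * ‖x‖) := by gcongr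
        _ = (2 * r) ^ (n + 1) * ‖x‖ := by ring
  have hlim : Filter.Tendsto (fun n : ℕ => (2 * r / R) ^ n * ‖x‖) Filter.atTop (nhds 0) := by
    simpa using (tendsto_pow_atTop_nhds_zero_of_lt_one (by positivity)
      ((div_lt_one hR0).2 hR)).mul_const ‖x‖
  refine norm_le_zero_iff.1 (ge_of_tendsto' hlim fun n => ?_)
  rw [div_pow, div_mul_eq_mul_div, le_div_iff₀ (by positivity), mul_comm]
  exact key n x hx

/-- `indProj_eq_zero_of_far` needs sets of small radius, so `F` is cut into countably many disjoint
pieces, each in a ball of radius `δ`. -/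
theorem indProj_infDist_eq_zero {V : H ≃ₗᵢ[ℂ] Lp ℂ 2 μ} {z : X → ℂ} (hz : Measurable z)
    {E : ResolutionOfIdentity H} (hE : E.IsIntegral (fun w => w) (mulOp V z)) {F : Set ℂ}
    (hF : IsClosed F) {δ : ℝ} (hδ : 0 < δ) (x : H) :
    indProj V (z ⁻¹' {w | 4 * δ ≤ Metric.infDist w F}) (E.proj F x) = 0 := by
  have hG : MeasurableSet (z ⁻¹' {w | 4 * δ ≤ Metric.infDist w F}) :=
    hz (measurableSet_le measurable_const (Metric.continuous_infDist_pt F).measurable)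
  let a : ℕ → ℂ := TopologicalSpace.denseSeq ℂ
  let p : ℕ → Set ℂ := disjointed fun n => Metric.closedBall (a n) δ
  have hp : ∀ n, MeasurableSet (p n) :=
    fun n => MeasurableSet.disjointed (fun n => measurableSet_closedBall) n
  have hpU : (⋃ n, p n) = Set.univ := by
    rw [iUnion_disjointed]
    refine Set.eq_univ_of_forall fun w => Set.mem_iUnion.2 ?_
    obtain ⟨n, hn⟩ := (TopologicalSpace.denseRange_denseSeq ℂ).exists_dist_lt w hδ
    exact ⟨n, hn.le⟩
  have hsum := E.hasSum_iUnion (fun n => p n ∩ F) (fun n => (hp n).inter hF.measurableSet)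
    (fun i j hij => (disjoint_disjointed _ hij).mono Set.inter_subset_left Set.inter_subset_left) x
  rw [← Set.iUnion_inter, hpU, Set.univ_inter] at hsum
  have hsum' := hsum.mapL (indProj V (z ⁻¹' {w | 4 * δ ≤ Metric.infDist w F}))
  refine hsum'.unique ?_
  convert hasSum_zero using 1
  funext n
  rcases (p n ∩ F).eq_empty_or_nonempty with he | ⟨w₀, hw₀, hw₀F⟩
  · rw [he, E.proj_empty, map_zero]
  · have hm := (hp n).inter hF.measurableSet
    have hpn : p n ⊆ Metric.closedBall (a n) δ := disjointed_subset _ n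
    -- A point at distance at least `4δ` from `F` is at least `3δ` from the center of any ball whose
    -- piece meets `F`, and `3δ > 2δ`.
    refine indProj_eq_zero_of_far hz hE hm hδ.le (R := 3 * δ) (by linarith)
      (Set.inter_subset_left.trans hpn) hG (fun y hy => ?_)
      (by rw [E.proj_proj hm hm, Set.inter_self])
    have h1 : 4 * δ ≤ dist (z y) w₀ := le_trans hy (Metric.infDist_le_dist_of_mem hw₀F)
    have h2 : dist w₀ (a n) ≤ δ := hpn hw₀
    have h3 := dist_triangle_right (z y) w₀ (a n)
    rw [← dist_eq_norm]
    linarith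

theorem indProj_compl_eq_zero {V : H ≃ₗᵢ[ℂ] Lp ℂ 2 μ} {z : X → ℂ} (hz : Measurable z)
    {E : ResolutionOfIdentity H} (hE : E.IsIntegral (fun w => w) (mulOp V z)) {F : Set ℂ}
    (hF : IsClosed F) (x : H) : indProj V (z ⁻¹' Fᶜ) (E.proj F x) = 0 := by
  rcases F.eq_empty_or_nonempty with rfl | hne
  · rw [E.proj_empty, map_zero]
  have hU : z ⁻¹' Fᶜ ⊆ ⋃ n : ℕ, z ⁻¹' {w | 4 * (1 / ((n : ℝ) + 1)) ≤ Metric.infDist w F} := by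
    intro y hy
    have hpos : 0 < Metric.infDist (z y) F := (hF.notMem_iff_infDist_pos hne).1 hy
    obtain ⟨n, hn⟩ := exists_nat_one_div_lt (show 0 < Metric.infDist (z y) F / 4 by linarith)
    refine Set.mem_iUnion.2 ⟨n, ?_⟩
    change 4 * (1 / ((n : ℝ) + 1)) ≤ _
    linarith
  have h0 : density V (E.proj F x) (z ⁻¹' Fᶜ) = 0 := by
    refine measure_mono_null hU (measure_iUnion_null fun n => ?_)
    rw [density_apply V _ (hz (measurableSet_le measurable_const
      (Metric.continuous_infDist_pt F).measurable)),
      indProj_infDist_eq_zero hz hE hF (by positivity) x]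
    simp
  have := norm_indProj_sq V (E.proj F x) (hz hF.measurableSet.compl)
  rw [measureReal_def, h0] at this
  simpa using this

/-- Uniqueness of the resolution of the identity of a multiplication operator, in terms of the
scalar spectral measures. -/
theorem scalarMeasure_eq_of_isIntegral {V : H ≃ₗᵢ[ℂ] Lp ℂ 2 μ} {z : X → ℂ} (hz : Measurable z)
    {E : ResolutionOfIdentity H} (hE : E.IsIntegral (fun w => w) (mulOp V z)) (x : H) :
    E.scalarMeasure x = (mulResolution V z hz).scalarMeasure x := by
  refine measure_eq_of_le_isClosed (fun F hF => ?_) ?_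
  · have hFm := hF.measurableSet
    set E₀ := mulResolution V z hz
    -- The range of `E(F)` lies in that of `E₀(F)`; Cauchy–Schwarz then gives `‖E(F)x‖ ≤ ‖E₀(F)x‖`.
    have h1 : E₀.proj F (E.proj F x) = E.proj F x := by
      have := E₀.proj_compl (E.proj F x) hFm
      rw [mulResolution_proj V z hz hFm.compl, indProj_compl_eq_zero hz hE hF x, eq_comm,
        sub_eq_zero] at this
      exact this.symm
    have h2 : ‖E.proj F x‖ ≤ ‖E₀.proj F x‖ := by
      have h3 : ‖E.proj F x‖ * ‖E.proj F x‖ ≤ ‖E₀.proj F x‖ * ‖E.proj F x‖ := by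
        calc ‖E.proj F x‖ * ‖E.proj F x‖ = ‖inner ℂ (E.proj F x) (E.proj F x)‖ := by
              simp [inner_self_eq_norm_sq_to_K, sq]
          _ = ‖inner ℂ (E₀.proj F x) (E.proj F x)‖ := by
              rw [E.inner_proj_left hFm, E.proj_proj hFm hFm, Set.inter_self,
                E₀.inner_proj_left hFm, h1]
          _ ≤ _ := norm_inner_le_norm _ _
      rcases (norm_nonneg (E.proj F x)).eq_or_lt with h0 | h0
      · rw [← h0]
        exact norm_nonneg _
      · exact le_of_mul_le_mul_right h3 h0
    rw [E.scalarMeasure_apply x hFm, E₀.scalarMeasure_apply x hFm]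
    gcongr
  · rw [E.scalarMeasure_univ, ResolutionOfIdentity.scalarMeasure_univ]

theorem isFunctionOf_mulOp (V : H ≃ₗᵢ[ℂ] Lp ℂ 2 μ) {z : X → ℂ} (hz : Measurable z) {φ : ℂ → ℂ}
    (hφ : Measurable φ) : IsFunctionOf (mulOp V z) φ (mulOp V (φ ∘ z)) :=
  ⟨mulResolution V z hz, isIntegral_mulResolution V hz measurable_id,
    isIntegral_mulResolution V hz hφ⟩

/-- `IsIntegral` sees a resolution only through its scalar measures, so their equality is enough and
the projections need not be compared. -/
theorem IsFunctionOf.eq_mulOp {V : H ≃ₗᵢ[ℂ] Lp ℂ 2 μ} {z : X → ℂ} (hz : Measurable z) {φ : ℂ → ℂ}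
    (hφ : Measurable φ) {A : H →ₗ.[ℂ] H} (hA : IsFunctionOf (mulOp V z) φ A) :
    A = mulOp V (φ ∘ z) := by
  obtain ⟨E, hE, hEA⟩ := hA
  have hB := isIntegral_mulResolution V hz hφ
  have hdom : ∀ x, x ∈ (mulOp V (φ ∘ z)).domain ↔ x ∈ A.domain := fun x => by
    rw [hB.1, hEA.1, scalarMeasure_eq_of_isIntegral hz hE]
  refine (linearPMap_ext_of_quadratic (dense_mulOp_domain V (hφ.comp hz)) hdom
    fun x hx hx' => ?_).symm
  rw [hB.2 ⟨x, hx⟩, hEA.2 ⟨x, hx'⟩, scalarMeasure_eq_of_isIntegral hz hE]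

theorem isFunctionOf_functionalCalculus {N : H →ₗ.[ℂ] H} {φ : ℂ → ℂ} {A : H →ₗ.[ℂ] H}
    (hA : IsFunctionOf N φ A) : IsFunctionOf N φ (functionalCalculus N φ) := by
  have h : ∃ A, IsFunctionOf N φ A := ⟨A, hA⟩
  rw [functionalCalculus, dif_pos h]
  exact h.choose_spec

theorem functionalCalculus_mulOp (V : H ≃ₗᵢ[ℂ] Lp ℂ 2 μ) {z : X → ℂ} (hz : Measurable z)
    {φ : ℂ → ℂ} (hφ : Measurable φ) : functionalCalculus (mulOp V z) φ = mulOp V (φ ∘ z) :=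
  (isFunctionOf_functionalCalculus (isFunctionOf_mulOp V hz hφ)).eq_mulOp hz hφ

end Uniqueness

/-! ### Invertibility of multiplication operators -/

section Invertibility

variable {X : Type*} [MeasurableSpace X] {μ : Measure X}
variable {H : Type*} [NormedAddCommGroup H] [InnerProductSpace ℂ H]

theorem isInvertible_mulOp_of_le (V : H ≃ₗᵢ[ℂ] Lp ℂ 2 μ) {m : X → ℂ} (hm : Measurable m) {ε : ℝ}
    (hε : 0 < ε) (h : ∀ᵐ t ∂μ, ε ≤ ‖m t‖) : IsInvertible (mulOp V m) := by
  have hB : ∀ᵐ t ∂μ, ‖(m t)⁻¹‖ ≤ ε⁻¹ := by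
    filter_upwards [h] with t ht
    rw [norm_inv]
    exact inv_anti₀ hε ht
  let B := mulCLM V (fun t => (m t)⁻¹) hm.inv.aestronglyMeasurable ε⁻¹ hB
  have hBV : ∀ u, V (B u) =ᵐ[μ] fun t => (m t)⁻¹ * V u t := coeFn_mulCLM V _ _ _ _
  have hAB : ∀ u, V u =ᵐ[μ] fun t => m t * V (B u) t := by
    intro u
    filter_upwards [h, hBV u] with t ht htB
    have h0 : m t ≠ 0 := norm_pos_iff.1 (hε.trans_le ht)
    rw [htB, mul_inv_cancel_left₀ h0]
  have hBA : ∀ v : (mulOp V m).domain, B (mulOp V m v) = v := by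
    intro v
    refine ext_of_ae V ?_
    filter_upwards [h, hBV (mulOp V m v), coeFn_mulOp V m v] with t ht htB htA
    have h0 : m t ≠ 0 := norm_pos_iff.1 (hε.trans_le ht)
    rw [htB, htA, inv_mul_cancel_left₀ h0]
  refine ⟨B, ?_, fun u hu => mulOp_eq_of_ae (hAB u), hBA⟩
  ext v
  constructor
  · rintro ⟨u, rfl⟩
    exact mem_mulOp_domain_of_ae (hAB u)
  · exact fun hv => ⟨_, hBA ⟨v, hv⟩⟩

/-- If `m` were small on a set of positive measure, the indicator of a subset of finite positive
measure would be shrunk by more than a bounded left inverse can undo. -/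
theorem exists_le_of_isInvertible_mulOp [SigmaFinite μ] {V : H ≃ₗᵢ[ℂ] Lp ℂ 2 μ} {m : X → ℂ}
    (hm : Measurable m) (h : IsInvertible (mulOp V m)) : ∃ ε : ℝ, 0 < ε ∧ ∀ᵐ t ∂μ, ε ≤ ‖m t‖ := by
  obtain ⟨B, -, -, hBA⟩ := h
  -- Any `ε > 0` with `‖B‖ ε < 1` works; the `+ 1` also covers `B = 0`.
  refine ⟨1 / (‖B‖ + 1), by positivity, ?_⟩
  set ε : ℝ := 1 / (‖B‖ + 1) with hε
  have hε0 : 0 < ε := by positivity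
  by_contra hcon
  have hS : MeasurableSet {t | ‖m t‖ < ε} := measurableSet_lt hm.norm measurable_const
  have hpos : 0 < μ {t | ‖m t‖ < ε} := by
    rw [ae_iff] at hcon
    simpa [pos_iff_ne_zero] using hcon
  obtain ⟨s, hs, hsub, hs0, hfin⟩ := Measure.exists_subset_measure_lt_top hS hpos
  let f : Lp ℂ 2 μ := indicatorConstLp 2 hs hfin.ne (1 : ℂ)
  have hf : ⇑f =ᵐ[μ] s.indicator fun _ => (1 : ℂ) := indicatorConstLp_coeFn
  have hfne : 0 < ‖f‖ := by
    rw [norm_indicatorConstLp (by simp) (by simp)]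
    have : 0 < μ.real s := ENNReal.toReal_pos hs0.ne' hfin.ne
    exact mul_pos (by simp) (Real.rpow_pos_of_pos this _)
  set x := V.symm f
  have hVx : V x = f := V.apply_symm_apply f
  have hbound : ∀ᵐ t ∂μ, ‖m t * V x t‖ ≤ ε * ‖V x t‖ := by
    rw [hVx]
    filter_upwards [hf] with t ht
    rw [norm_mul, ht]
    by_cases hts : t ∈ s
    · exact mul_le_mul_of_nonneg_right (le_of_lt (hsub hts)) (norm_nonneg _)
    · simp [hts]
  have hx : x ∈ (mulOp V m).domain :=
    (Lp.memLp (V x)).of_le_mul (hm.aestronglyMeasurable.mul (Lp.aestronglyMeasurable _)) hbound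
  have h1 : ‖mulOp V m ⟨x, hx⟩‖ ≤ ε * ‖x‖ := by
    rw [← V.norm_map, ← V.norm_map x]
    refine Lp.norm_le_mul_norm_of_ae_le_mul ?_
    filter_upwards [hbound, coeFn_mulOp V m ⟨x, hx⟩] with t ht ht'
    rwa [ht']
  have hx0 : 0 < ‖x‖ := by rwa [← V.norm_map, hVx]
  have h2 : ‖x‖ ≤ ‖B‖ * (ε * ‖x‖) := by
    calc ‖x‖ = ‖B (mulOp V m ⟨x, hx⟩)‖ := by rw [hBA ⟨x, hx⟩]
      _ ≤ ‖B‖ * ‖mulOp V m ⟨x, hx⟩‖ := B.le_opNorm _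
      _ ≤ _ := by gcongr
  have h3 : ‖B‖ * ε < 1 := by
    rw [hε, mul_one_div, div_lt_one (by positivity)]
    linarith
  nlinarith

theorem isInvertible_mulOp_iff [SigmaFinite μ] (V : H ≃ₗᵢ[ℂ] Lp ℂ 2 μ) {m : X → ℂ}
    (hm : Measurable m) : IsInvertible (mulOp V m) ↔ ∃ ε : ℝ, 0 < ε ∧ ∀ᵐ t ∂μ, ε ≤ ‖m t‖ :=
  ⟨exists_le_of_isInvertible_mulOp hm, fun ⟨_, hε, h⟩ => isInvertible_mulOp_of_le V hm hε h⟩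

end Invertibility

/-! ### Locally absolutely continuous functions -/

section AbsolutelyContinuous

theorem isAC_of_contDiff {g : ℝ → ℂ} (hg : ContDiff ℝ 1 g) : IsAC g :=
  fun _ _ => hg.contDiffOn.absolutelyContinuousOnInterval

theorem IsAC.mul {f g : ℝ → ℂ} (hf : IsAC f) (hg : IsAC g) : IsAC fun t => f t * g t :=
  fun a b => (hf a b).smul (hg a b)

theorem absolutelyContinuousOnInterval_primitive {f : ℝ → ℝ} (hf : LocallyIntegrable f)
    (x a b : ℝ) :
    AbsolutelyContinuousOnInterval (fun t => ∫ s in x..t, f s) a b := by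
  -- The interval is enlarged to contain the base point `x`, and the result is restricted
  -- afterwards.
  have h : IntervalIntegrable f volume (min x (min a b)) (max x (max a b)) :=
    (hf.integrableOn_isCompact isCompact_uIcc).intervalIntegrable
  refine (h.absolutelyContinuousOnInterval_intervalIntegral (c := x) ?_).mono ?_
  · rw [Set.mem_uIcc]
    exact Or.inl ⟨min_le_left _ _, le_max_left _ _⟩
  · have h : min x (min a b) ≤ max x (max a b) := (min_le_left _ _).trans (le_max_left _ _)
    rw [Set.uIcc_of_le h]
    exact Set.Icc_subset_Icc (min_le_right _ _) (le_max_right _ _)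

theorem isAC_primitive {f : ℝ → ℂ} (hf : LocallyIntegrable f) (x : ℝ) :
    IsAC fun t => ∫ s in x..t, f s := by
  intro a b
  have hi : ∀ t, IntervalIntegrable f volume x t := fun t =>
    (hf.integrableOn_isCompact isCompact_uIcc).intervalIntegrable
  have hre : LocallyIntegrable fun t => (f t).re := fun t =>
    let ⟨s, hs, h⟩ := hf t
    ⟨s, hs, h.re⟩
  have him : LocallyIntegrable fun t => (f t).im := fun t =>
    let ⟨s, hs, h⟩ := hf t
    ⟨s, hs, h.im⟩
  have hconst : ∀ w : ℂ, AbsolutelyContinuousOnInterval (fun _ : ℝ => w) a b := fun w =>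
    (LipschitzWith.const w).lipschitzOnWith.absolutelyContinuousOnInterval
  have h := ((absolutelyContinuousOnInterval_primitive hre x a b).smul (hconst 1)).add
    ((absolutelyContinuousOnInterval_primitive him x a b).smul (hconst Complex.I))
  refine (congrArg (fun F : ℝ → ℂ => AbsolutelyContinuousOnInterval F a b) ?_).mpr h
  funext t
  have e1 := Complex.reCLM.intervalIntegral_comp_comm (hi t)
  have e2 := Complex.imCLM.intervalIntegral_comp_comm (hi t)
  simp only [Complex.reCLM_apply, Complex.imCLM_apply] at e1 e2
  simp only [Pi.add_apply, Pi.smul_apply', e1, e2]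
  simp [Complex.re_add_im]

/-- A locally absolutely continuous solution of `g' = k g` is a multiple of the exponential. -/
theorem IsAC.eq_exp_of_deriv {g : ℝ → ℂ} (hg : IsAC g) {k : ℂ} (h : ∀ᵐ t, deriv g t = k * g t) :
    ∃ C : ℂ, ∀ t : ℝ, g t = C * Complex.exp (k * t) := by
  have hexp : ∀ t : ℝ, HasDerivAt (fun t : ℝ => Complex.exp (-k * t))
      (Complex.exp (-k * t) * (-k)) t := fun t => by
    simpa using ((Complex.ofRealCLM.hasDerivAt (x := t)).const_mul (-k)).cexp
  -- The integrating factor: this product is absolutely continuous with derivative zero almost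
  -- everywhere, hence constant.
  have hAC : IsAC fun t : ℝ => Complex.exp (-k * t) * g t :=
    (isAC_of_contDiff (contDiff_const.mul Complex.ofRealCLM.contDiff).cexp).mul hg
  have hder : ∀ᵐ t : ℝ, HasDerivAt (fun t : ℝ => Complex.exp (-k * t) * g t) 0 t := by
    filter_upwards [h, hg.ae_differentiableAt] with t ht hd
    have h1 := (hexp t).mul hd.hasDerivAt
    rw [ht, show Complex.exp (-k * t) * -k * g t + Complex.exp (-k * t) * (k * g t) = 0 by ring]
      at h1
    exact h1
  refine ⟨g 0, fun t => ?_⟩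
  obtain ⟨C, hC⟩ := (hAC 0 t).const_of_ae_hasDerivAt_zero (hder.mono fun x hx _ => hx)
  have h1 := hC 0 Set.left_mem_uIcc
  have h2 := hC t Set.right_mem_uIcc
  simp only [Complex.ofReal_zero, mul_zero, Complex.exp_zero, one_mul] at h1
  rw [h1, ← h2, mul_right_comm, ← Complex.exp_add]
  simp

end AbsolutelyContinuous

/-! ### Removing the weight -/

section Weight

theorem eLpNorm_weight (c : ℝ) (f : ℝ → ℂ) :
    eLpNorm (fun t : ℝ => Complex.exp (-c * t) * f t) 2 volume = eLpNorm f 2 (weight c) := by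
  rw [eLpNorm_eq_lintegral_rpow_enorm_toReal (by simp) (by simp),
    eLpNorm_eq_lintegral_rpow_enorm_toReal (by simp) (by simp), weight,
    lintegral_withDensity_eq_lintegral_mul_non_measurable _ (by fun_prop)
      (by filter_upwards with t; exact ENNReal.ofReal_lt_top)]
  congr 1
  refine lintegral_congr fun t => ?_
  have h : ‖Complex.exp (-c * t)‖ₑ ^ 2 = ENNReal.ofReal (Real.exp (-2 * c * t)) := by
    rw [← ofReal_norm, Complex.norm_exp, ← ENNReal.ofReal_pow (Real.exp_pos _).le,
      ← Real.exp_nat_mul]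
    congr 2
    simp
    ring
  simp only [ENNReal.toReal_ofNat, ENNReal.rpow_ofNat, Pi.mul_apply, enorm_mul, mul_pow, h]

theorem memLp_weight_iff (c : ℝ) (f : ℝ → ℂ) :
    MemLp (fun t : ℝ => Complex.exp (-c * t) * f t) 2 volume ↔ MemLp f 2 (weight c) := by
  have hexp : ∀ a : ℝ, AEStronglyMeasurable (fun t : ℝ => Complex.exp (a * t)) volume := fun a =>
    (by fun_prop : Continuous fun t : ℝ => Complex.exp (a * t)).aestronglyMeasurable
  rw [MemLp, MemLp, eLpNorm_weight]
  refine and_congr_left fun _ => ⟨fun h => ?_, fun h => ?_⟩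
  · have h2 := ((hexp c).mul h).mono_ac (weight_ac_volume c)
    refine h2.congr (Filter.Eventually.of_forall fun t => ?_)
    simp only [Pi.mul_apply]
    rw [← mul_assoc, ← Complex.exp_add]
    simp
  · have h2 := (hexp (-c)).mul (h.mono_ac (volume_ac_weight c))
    refine h2.congr (Filter.Eventually.of_forall fun t => ?_)
    simp only [Pi.mul_apply, Complex.ofReal_neg]

/-- Multiplication by `e^{-ct}`, a unitary map from the weighted to the unweighted space. -/
def weightIsometry (c : ℝ) : Hc c →ₗᵢ[ℂ] Lp ℂ 2 (volume : Measure ℝ) where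
  toFun f := ((memLp_weight_iff c f).2 (Lp.memLp f)).toLp
  map_add' f g := by
    rw [← MemLp.toLp_add]
    refine MemLp.toLp_congr _ _ ?_
    filter_upwards [(volume_ac_weight c).ae_le (Lp.coeFn_add f g)] with t ht
    rw [ht, Pi.add_apply, Pi.add_apply, mul_add]
  map_smul' a f := by
    rw [RingHom.id_apply, ← MemLp.toLp_const_smul]
    refine MemLp.toLp_congr _ _ ?_
    filter_upwards [(volume_ac_weight c).ae_le (Lp.coeFn_smul a f)] with t ht
    rw [ht, Pi.smul_apply, Pi.smul_apply, smul_eq_mul, smul_eq_mul, mul_left_comm]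
  norm_map' f := by
    refine (Lp.norm_toLp _ ((memLp_weight_iff c f).2 (Lp.memLp f))).trans ?_
    rw [eLpNorm_weight, Lp.norm_def]

theorem coeFn_weightIsometry (c : ℝ) (f : Hc c) :
    weightIsometry c f =ᵐ[volume] fun t : ℝ => Complex.exp (-c * t) * f t :=
  MemLp.coeFn_toLp ((memLp_weight_iff c f).2 (Lp.memLp f))

theorem surjective_weightIsometry (c : ℝ) : Function.Surjective (weightIsometry c) := by
  intro g
  have h : ∀ t : ℝ, Complex.exp (-c * t) * (Complex.exp (c * t) * g t) = g t := fun t => by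
    rw [← mul_assoc, ← Complex.exp_add]
    simp
  have hg : MemLp (fun t : ℝ => Complex.exp (c * t) * g t) 2 (weight c) := by
    rw [← memLp_weight_iff]
    simp only [h]
    exact Lp.memLp g
  refine ⟨hg.toLp, Lp.ext ?_⟩
  filter_upwards [coeFn_weightIsometry c hg.toLp,
    (volume_ac_weight c).ae_le hg.coeFn_toLp] with t h1 h2
  rw [h1, h2, h]

end Weight

/-! ### Derivatives in `L²` through the Fourier transform -/

section Fourier

open FourierTransform SchwartzMap

/-- The limit in `L²` of a sequence of smooth functions whose derivatives converge as well has an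
absolutely continuous representative. -/
theorem exists_isAC_of_tendsto {p : ℕ → 𝓢(ℝ, ℂ)} {u v : Lp ℂ 2 (volume : Measure ℝ)}
    (hu : Filter.Tendsto (fun n => (p n).toLp 2) Filter.atTop (nhds u))
    (hv : Filter.Tendsto (fun n => (derivCLM ℂ ℂ (p n)).toLp 2) Filter.atTop (nhds v)) :
    ∃ g : ℝ → ℂ, IsAC g ∧ u =ᵐ[volume] g ∧ v =ᵐ[volume] deriv g := by
  -- Integration over a bounded interval is an inner product with an indicator, hence continuous on
  -- `L²`.
  have hset : ∀ a b : ℝ, Filter.Tendsto (fun n => ∫ t in Set.Ioc a b, deriv (p n) t) Filter.atTop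
      (nhds (∫ t in Set.Ioc a b, v t)) := by
    intro a b
    let χ : Lp ℂ 2 (volume : Measure ℝ) :=
      indicatorConstLp 2 (measurableSet_Ioc (a := a) (b := b)) measure_Ioc_lt_top.ne (1 : ℂ)
    have h := ((innerSL ℂ χ).continuous.tendsto v).comp hv
    have hχ : ∀ f, innerSL ℂ χ f = ∫ t in Set.Ioc a b, f t := fun f =>
      L2.inner_indicatorConstLp_one _ _ f
    simp only [Function.comp_def, hχ] at h
    refine h.congr fun n => integral_congr_ae (ae_restrict_of_ae ?_)
    exact coeFn_toLp _ 2 volume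
  have hint : ∀ a b : ℝ, Filter.Tendsto (fun n => p n b - p n a) Filter.atTop
      (nhds (∫ t in a..b, v t)) := by
    intro a b
    have h1 : ∀ n, p n b - p n a = ∫ t in a..b, deriv (p n) t := fun n =>
      (intervalIntegral.integral_deriv_eq_sub (fun t _ => (p n).differentiableAt)
        ((derivCLM ℂ ℂ (p n)).continuous.intervalIntegrable _ _)).symm
    simp only [h1, intervalIntegral]
    exact (hset a b).sub (hset b a)
  obtain ⟨ns, hns, hae⟩ := (tendstoInMeasure_of_tendsto_Lp hu).exists_seq_tendsto_ae
  have hpt : ∀ᵐ t : ℝ, Filter.Tendsto (fun n => p (ns n) t) Filter.atTop (nhds (u t)) := by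
    have : ∀ᵐ t : ℝ, ∀ n, (p n).toLp 2 volume t = p n t :=
      ae_all_iff.2 fun n => (p n).coeFn_toLp 2 volume
    filter_upwards [hae, this] with t h1 h2
    simpa only [h2] using h1
  -- A base point where a subsequence converges; there the fundamental theorem of calculus passes to
  -- the limit.
  obtain ⟨a, ha⟩ := hpt.exists
  have hloc : LocallyIntegrable v := (Lp.memLp v).locallyIntegrable one_le_two
  have hconst : IsAC fun _ => u a := isAC_of_contDiff contDiff_const
  refine ⟨fun t => u a + ∫ s in a..t, v s,
    fun x y => (hconst x y).add (isAC_primitive hloc a x y), ?_, ?_⟩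
  · filter_upwards [hpt] with t ht
    have h1 := tendsto_nhds_unique (ht.sub ha) ((hint a t).comp hns.tendsto_atTop)
    rw [← h1]
    ring
  · filter_upwards [LocallyIntegrable.ae_hasDerivAt_integral hloc] with t ht
    exact ((ht a).const_add (u a)).deriv.symm

theorem two_pi_I_mul_sub_one_ne_zero (ξ : ℝ) : 2 * Real.pi * Complex.I * ξ - 1 ≠ 0 := by
  intro h
  have := congrArg Complex.re h
  simp at this

theorem one_le_norm_two_pi_I_mul_sub_one (ξ : ℝ) : 1 ≤ ‖2 * Real.pi * Complex.I * ξ - 1‖ := by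
  have := Complex.abs_re_le_norm (2 * Real.pi * Complex.I * ξ - 1)
  simpa using this

/-- The function equals `-(1 + 2πiξ) (1 + (2πξ)²)⁻¹`. Temperate growth makes multiplication by it an
operator on Schwartz functions. -/
theorem hasTemperateGrowth_resolvent :
    (fun ξ : ℝ => (2 * Real.pi * Complex.I * ξ - 1)⁻¹).HasTemperateGrowth := by
  have h1 : (fun ξ : ℝ => (1 + ‖2 * Real.pi * ξ‖ ^ 2) ^ (-1 : ℝ)).HasTemperateGrowth :=
    (Function.hasTemperateGrowth_one_add_norm_sq_rpow ℝ (-1)).comp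
      ((Function.HasTemperateGrowth.const _).mul Function.HasTemperateGrowth.id')
  have h2 : (fun ξ : ℝ => -(1 + 2 * Real.pi * Complex.I * (ξ : ℂ))).HasTemperateGrowth :=
    ((Function.HasTemperateGrowth.const _).add
      ((Function.HasTemperateGrowth.const _).mul Function.Complex.hasTemperateGrowth_ofReal)).neg
  have h3 := h2.mul (Function.Complex.hasTemperateGrowth_ofReal.comp h1)
  refine (congrArg (fun F : ℝ → ℂ => F.HasTemperateGrowth) ?_).mpr h3
  funext ξ
  have hne : (1 + (2 * Real.pi * ξ) ^ 2 : ℂ) ≠ 0 := by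
    exact_mod_cast (by positivity : (0 : ℝ) < 1 + (2 * Real.pi * ξ) ^ 2).ne'
  refine inv_eq_of_mul_eq_one_right ?_
  simp only [Pi.mul_apply, Function.comp_apply, Real.rpow_neg_one, Real.norm_eq_abs, sq_abs]
  push_cast
  rw [← mul_assoc, mul_inv_eq_one₀ hne]
  linear_combination (-4 * (Real.pi : ℂ) ^ 2 * ξ ^ 2) * Complex.I_sq

/-- A square-integrable function has an absolutely continuous representative with
square-integrable derivative if its Fourier transform is square-integrable after multiplication by
the variable. -/
theorem exists_isAC_of_fourier {u v : Lp ℂ 2 (volume : Measure ℝ)}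
    (h : Lp.fourierTransformₗᵢ ℝ ℂ v =ᵐ[volume]
      fun ξ => 2 * Real.pi * Complex.I * ξ * (Lp.fourierTransformₗᵢ ℝ ℂ u) ξ) :
    ∃ g : ℝ → ℂ, IsAC g ∧ u =ᵐ[volume] g ∧ v =ᵐ[volume] deriv g := by
  -- Approximating `w = (2πiξ - 1) û` rather than `û` controls function and derivative together: if
  -- Schwartz functions `s n` tend to `w`, then `q n = (2πiξ - 1)⁻¹ s n` tends to `û`, because
  -- `|2πiξ - 1| ≥ 1`, and `2πiξ q n = s n + q n` tends to `w + û`, the transform of `v`.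
  obtain ⟨w, hw⟩ : ∃ w : Lp ℂ 2 (volume : Measure ℝ), 
      w = Lp.fourierTransformₗᵢ ℝ ℂ v - Lp.fourierTransformₗᵢ ℝ ℂ u := ⟨_, rfl⟩
  have hwae : w =ᵐ[volume] fun ξ => (2 * Real.pi * Complex.I * ξ - 1) *
      (Lp.fourierTransformₗᵢ ℝ ℂ u) ξ := by
    rw [hw]
    filter_upwards [Lp.coeFn_sub (Lp.fourierTransformₗᵢ ℝ ℂ v) (Lp.fourierTransformₗᵢ ℝ ℂ u),
      h] with ξ h1 h2
    rw [h1, Pi.sub_apply, h2]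
    ring
  obtain ⟨σ, hσ, hlim⟩ := mem_closure_iff_seq_limit.1
    (denseRange_toLpCLM (F := ℂ) (p := 2) (μ := (volume : Measure ℝ)) ENNReal.ofNat_ne_top w)
  choose s hs using hσ
  have hs' : ∀ n, (s n).toLp 2 = σ n := hs
  let q : ℕ → 𝓢(ℝ, ℂ) := fun n =>
    smulLeftCLM ℂ (fun ξ : ℝ => (2 * Real.pi * Complex.I * ξ - 1)⁻¹) (s n)
  have hq : ∀ n ξ, q n ξ = (2 * Real.pi * Complex.I * ξ - 1)⁻¹ * s n ξ := fun n ξ =>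
    smulLeftCLM_apply_apply hasTemperateGrowth_resolvent _ _
  have hslim : Filter.Tendsto (fun n => (s n).toLp 2) Filter.atTop (nhds w) := by
    simpa only [hs'] using hlim
  have hqlim : Filter.Tendsto (fun n => (q n).toLp 2) Filter.atTop
      (nhds (Lp.fourierTransformₗᵢ ℝ ℂ u)) := by
    rw [tendsto_iff_norm_sub_tendsto_zero] at hslim ⊢
    refine squeeze_zero (fun _ => norm_nonneg _) (fun n => ?_) hslim
    refine Lp.norm_le_norm_of_ae_le ?_
    filter_upwards [Lp.coeFn_sub ((q n).toLp 2) (Lp.fourierTransformₗᵢ ℝ ℂ u),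
      Lp.coeFn_sub ((s n).toLp 2) w, (q n).coeFn_toLp 2 volume, (s n).coeFn_toLp 2 volume,
      hwae] with ξ h1 h2 h3 h4 h5
    rw [h1, h2, Pi.sub_apply, Pi.sub_apply, h3, h4, h5, hq]
    have h6 := two_pi_I_mul_sub_one_ne_zero ξ
    have h7 : s n ξ - (2 * Real.pi * Complex.I * ξ - 1) * (Lp.fourierTransformₗᵢ ℝ ℂ u) ξ =
      (2 * Real.pi * Complex.I * ξ - 1) * ((2 * Real.pi * Complex.I * ξ - 1)⁻¹ * s n ξ -
        (Lp.fourierTransformₗᵢ ℝ ℂ u) ξ) := by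
      rw [mul_sub, mul_inv_cancel_left₀ h6]
    rw [h7, norm_mul]
    exact le_mul_of_one_le_left (norm_nonneg _) (one_le_norm_two_pi_I_mul_sub_one ξ)
  have hder : ∀ n, derivCLM ℂ ℂ (𝓕⁻ (q n)) = 𝓕⁻ (s n + q n) := by
    intro n
    have h1 := lineDerivOp_fourierInv_eq (q n) (1 : ℝ)
    have h2 : (2 * Real.pi * Complex.I) • smulLeftCLM ℂ (fun x : ℝ => inner ℝ x (1 : ℝ)) (q n) =
        s n + q n := by
      ext ξ
      rw [_root_.smul_apply, _root_.add_apply,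
        smulLeftCLM_apply_apply (Function.hasTemperateGrowth_inner_left (1 : ℝ)), hq]
      have h6 := two_pi_I_mul_sub_one_ne_zero ξ
      simp
      field_simp
      ring
    rw [h2] at h1
    rw [← h1]
    ext t
    rw [derivCLM_apply, lineDerivOp_apply_eq_fderiv, fderiv_apply_one_eq_deriv]
  refine exists_isAC_of_tendsto (p := fun n => 𝓕⁻ (q n)) ?_ ?_
  · simp only [← toLp_fourierInv_eq]
    have := ((Lp.fourierTransformₗᵢ ℝ ℂ).symm.continuous.tendsto _).comp hqlim
    rwa [LinearIsometryEquiv.symm_apply_apply] at this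
  · simp only [hder, ← toLp_fourierInv_eq]
    have hadd : ∀ n, (s n + q n).toLp 2 (volume : Measure ℝ) =
        (s n).toLp 2 volume + (q n).toLp 2 volume :=
      fun n => rfl
    simp only [hadd]
    have := ((Lp.fourierTransformₗᵢ ℝ ℂ).symm.continuous.tendsto _).comp (hslim.add hqlim)
    rwa [hw, sub_add_cancel, LinearIsometryEquiv.symm_apply_apply] at this

end Fourier

/-! ### Diagonalization of the infinitesimal shift -/

section Shift

/-- The unitary map that diagonalizes the infinitesimal shift: multiplication by `e^{-ct}` followed
by the Fourier transform. -/
def diagonalization (c : ℝ) : Hc c ≃ₗᵢ[ℂ] Lp ℂ 2 (volume : Measure ℝ) :=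
  (LinearIsometryEquiv.ofSurjective (weightIsometry c) (surjective_weightIsometry c)).trans
    (Lp.fourierTransformₗᵢ ℝ ℂ)

theorem diagonalization_apply (c : ℝ) (f : Hc c) :
    diagonalization c f = Lp.fourierTransformₗᵢ ℝ ℂ (weightIsometry c f) := rfl

/-- The parametrization of the line `Re s = c` by frequencies. -/
def symbol (c ξ : ℝ) : ℂ := c + 2 * Real.pi * Complex.I * ξ

theorem continuous_symbol (c : ℝ) : Continuous (symbol c) := by
  unfold symbol
  fun_prop

/-- Since `(e^{-ct} f)' = e^{-ct} (f' - c f)`, the unweighted statement applies to `f` and `h - c f`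
after multiplication by `e^{-ct}`. -/
theorem mem_shift_graph_of_symbol {c : ℝ} {f h : Hc c}
    (hfh : diagonalization c h =ᵐ[volume] fun ξ => symbol c ξ * diagonalization c f ξ) :
    (f, h) ∈ (infinitesimalShift c).graph := by
  obtain ⟨g, hg, hu, hv⟩ := exists_isAC_of_fourier
    (u := weightIsometry c f) (v := weightIsometry c (h - (c : ℂ) • f)) (by
      rw [← diagonalization_apply, ← diagonalization_apply, map_sub, map_smul]
      filter_upwards [Lp.coeFn_sub (diagonalization c h) ((c : ℂ) • diagonalization c f),
        Lp.coeFn_smul (c : ℂ) (diagonalization c f), hfh] with ξ h1 h2 h3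
      rw [h1, Pi.sub_apply, h2, h3, Pi.smul_apply, smul_eq_mul, symbol]
      ring)
  rw [mem_infinitesimalShift_graph]
  have hexp : ∀ t : ℝ, HasDerivAt (fun t : ℝ => Complex.exp (c * t))
      (Complex.exp (c * t) * c) t := fun t => by
    simpa using ((Complex.ofRealCLM.hasDerivAt (x := t)).const_mul (c : ℂ)).cexp
  have hcancel : ∀ (t : ℝ) (a : ℂ), Complex.exp (c * t) * (Complex.exp (-c * t) * a) = a := by
    intro t a
    rw [← mul_assoc, ← Complex.exp_add]
    simp
  refine ⟨fun t => Complex.exp (c * t) * g t,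
    (isAC_of_contDiff (contDiff_const.mul Complex.ofRealCLM.contDiff).cexp).mul hg, ?_, ?_⟩
  · refine (weight_ac_volume c).ae_le ?_
    filter_upwards [hu, coeFn_weightIsometry c f] with t h1 h2
    rw [← h1, h2, hcancel]
  · refine (weight_ac_volume c).ae_le ?_
    filter_upwards [hu, hv, coeFn_weightIsometry c f, coeFn_weightIsometry c (h - (c : ℂ) • f),
      (volume_ac_weight c).ae_le (Lp.coeFn_sub h ((c : ℂ) • f)),
      (volume_ac_weight c).ae_le (Lp.coeFn_smul (c : ℂ) f),
      hg.ae_differentiableAt] with t h1 h2 h3 h4 h5 h6 h7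
    have hd := ((hexp t).mul h7.hasDerivAt).deriv
    refine Eq.trans ?_ hd.symm
    rw [← h2, h4, h5, ← h1, h3, Pi.sub_apply, h6, hcancel, mul_assoc, mul_left_comm, hcancel]
    simp

/-- The infinitesimal shift has no eigenvalue `c + 1`. -/
theorem eq_zero_of_mem_shift_graph {c : ℝ} {f : Hc c}
    (hf : (f, ((c + 1 : ℝ) : ℂ) • f) ∈ (infinitesimalShift c).graph) : f = 0 := by
  obtain ⟨g, hg, hfg, hder⟩ := (mem_infinitesimalShift_graph c _ _).1 hf
  have hode : ∀ᵐ t : ℝ, deriv g t = ((c + 1 : ℝ) : ℂ) * g t := by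
    filter_upwards [(volume_ac_weight c).ae_le hfg, (volume_ac_weight c).ae_le hder,
      (volume_ac_weight c).ae_le (Lp.coeFn_smul ((c + 1 : ℝ) : ℂ) f)] with t h1 h2 h3
    rw [← h2, h3, Pi.smul_apply, h1, smul_eq_mul]
  obtain ⟨C, hC⟩ := hg.eq_exp_of_deriv hode
  have hmem : MemLp (fun t : ℝ => Complex.exp (-c * t) * g t) 2 volume :=
    (memLp_weight_iff c g).2 ((memLp_congr_ae hfg).1 (Lp.memLp f))
  have hC0 : C = 0 := by
    -- Here `e^{-ct} g` is `C e^t`, which dominates the constant `C` on a half-line of infinite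
    -- measure.
    have h1 : MemLp (fun _ : ℝ => C) 2 (volume.restrict (Set.Ici 0)) := by
      refine (hmem.restrict (Set.Ici 0)).of_le aestronglyMeasurable_const ?_
      filter_upwards [ae_restrict_mem measurableSet_Ici] with t ht
      have h2 : Complex.exp (-c * t) * g t = C * Complex.exp t := by
        rw [hC, mul_left_comm, ← Complex.exp_add]
        congr 2
        push_cast
        ring
      rw [h2, norm_mul, Complex.norm_exp, Complex.ofReal_re]
      exact le_mul_of_one_le_right (norm_nonneg _) (Real.one_le_exp ht)
    rw [memLp_const_iff (by simp) (by simp)] at h1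
    simpa using h1
  rw [Lp.eq_zero_iff_ae_eq_zero]
  filter_upwards [hfg] with t ht
  rw [ht, hC, hC0, zero_mul, Pi.zero_apply]

theorem symbol_sub (c ξ : ℝ) :
    symbol c ξ - ((c + 1 : ℝ) : ℂ) = 2 * Real.pi * Complex.I * ξ - 1 := by
  rw [symbol]
  push_cast
  ring

/-- The resolvent of the multiplication operator at `c + 1`. -/
theorem exists_symbol_resolvent (c : ℝ) (w : Hc c) : ∃ x : Hc c,
    diagonalization c (w + ((c + 1 : ℝ) : ℂ) • x) =ᵐ[volume]
      fun ξ => symbol c ξ * diagonalization c x ξ := by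
  have hm : Continuous fun ξ : ℝ => (2 * Real.pi * Complex.I * ξ - 1 : ℂ)⁻¹ :=
    (by fun_prop : Continuous fun ξ : ℝ => (2 * Real.pi * Complex.I * ξ - 1 : ℂ)).inv₀
      two_pi_I_mul_sub_one_ne_zero
  have hb : ∀ᵐ ξ : ℝ, ‖(2 * Real.pi * Complex.I * ξ - 1 : ℂ)⁻¹‖ ≤ 1 :=
    Filter.Eventually.of_forall fun ξ => by
      rw [norm_inv]
      exact inv_le_one_of_one_le₀ (one_le_norm_two_pi_I_mul_sub_one ξ)
  refine ⟨mulCLM (diagonalization c) _ hm.aestronglyMeasurable 1 hb w, ?_⟩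
  set x := mulCLM (diagonalization c) _ hm.aestronglyMeasurable 1 hb w with hx
  have hVx := coeFn_mulCLM (diagonalization c) _ hm.aestronglyMeasurable 1 hb w
  rw [← hx] at hVx
  rw [map_add, map_smul]
  filter_upwards [hVx, Lp.coeFn_add (diagonalization c w)
    (((c + 1 : ℝ) : ℂ) • diagonalization c x),
    Lp.coeFn_smul ((c + 1 : ℝ) : ℂ) (diagonalization c x)] with ξ h1 h2 h3
  have h4 : diagonalization c w ξ = (symbol c ξ - ((c + 1 : ℝ) : ℂ)) * diagonalization c x ξ := by
    rw [symbol_sub, h1, mul_inv_cancel_left₀ (two_pi_I_mul_sub_one_ne_zero ξ)]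
  rw [h2, Pi.add_apply, h3, Pi.smul_apply, smul_eq_mul, h4]
  ring

/-- The shift extends the multiplication operator by `mem_shift_graph_of_symbol`. The extension is
not proper: minus `c + 1`, the multiplication operator is surjective and the shift is injective. So
the Fourier transform of a general derivative is never computed. -/
theorem infinitesimalShift_eq_mulOp (c : ℝ) :
    infinitesimalShift c = mulOp (diagonalization c) (symbol c) := by
  refine LinearPMap.eq_of_eq_graph (Submodule.ext fun ⟨f, h⟩ => ⟨fun hfh => ?_, fun hfh => ?_⟩)
  · obtain ⟨x, hx⟩ := exists_symbol_resolvent c (h - ((c + 1 : ℝ) : ℂ) • f)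
    have h1 := Submodule.sub_mem _ hfh (mem_shift_graph_of_symbol hx)
    have h2 : f - x = 0 := by
      refine eq_zero_of_mem_shift_graph ?_
      convert h1 using 1
      rw [Prod.mk_sub_mk, smul_sub]
      congr 1
      abel
    rw [← sub_eq_zero.1 h2, sub_add_cancel] at hx
    exact (LinearPMap.mem_graph_iff _).2
      ⟨⟨f, mem_mulOp_domain_of_ae hx⟩, rfl, mulOp_eq_of_ae hx⟩
  · obtain ⟨x, rfl, rfl⟩ := (LinearPMap.mem_graph_iff _).1 hfh
    exact mem_shift_graph_of_symbol (coeFn_mulOp _ _ x)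

end Shift

/-! ### Values of `ζ` on the vertical line -/

section Zeta

theorem continuousOn_riemannZeta : ContinuousOn riemannZeta {1}ᶜ := fun _ hs =>
  (differentiableAt_riemannZeta hs).continuousAt.continuousWithinAt

theorem measurable_riemannZeta : Measurable riemannZeta :=
  measurable_of_continuousOn_compl_singleton 1 continuousOn_riemannZeta

theorem symbol_mem_verticalLine {c ξ : ℝ} (hξ : ξ ≠ 0) : symbol c ξ ∈ verticalLine c := by
  constructor
  · simp [symbol]
  · intro h
    have := congrArg Complex.im h
    simp [symbol, Real.pi_ne_zero, hξ] at this

theorem exists_symbol_eq {c : ℝ} {s : ℂ} (hs : s.re = c) : ∃ ξ, symbol c ξ = s := by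
  refine ⟨s.im / (2 * Real.pi), ?_⟩
  have hπ : (Real.pi : ℂ) ≠ 0 := by exact_mod_cast Real.pi_ne_zero
  have h : 2 * Real.pi * Complex.I * ((s.im / (2 * Real.pi) : ℝ) : ℂ) = s.im * Complex.I := by
    push_cast
    field_simp
  rw [symbol, h, ← hs, Complex.re_add_im]

/-- A function continuous off the point `1` is essentially bounded below on the line `Re s = c` if
and only if `0` is not a limit of its values there. -/
theorem exists_ae_le_norm_iff {φ : ℂ → ℂ} (hφ : ContinuousOn φ {1}ᶜ) (c : ℝ) :
    (∃ ε : ℝ, 0 < ε ∧ ∀ᵐ ξ : ℝ, ε ≤ ‖(φ ∘ symbol c) ξ‖) ↔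
      (0 : ℂ) ∉ closure (φ '' verticalLine c) := by
  constructor
  · rintro ⟨ε, hε, h⟩ h0
    obtain ⟨_, ⟨s, hs, rfl⟩, hsε⟩ := Metric.mem_closure_iff.1 h0 ε hε
    rw [dist_zero_left] at hsε
    obtain ⟨ξ, hξ⟩ := exists_symbol_eq hs.1
    have hc : ContinuousAt (fun ξ => ‖(φ ∘ symbol c) ξ‖) ξ := by
      refine ContinuousAt.norm (ContinuousAt.comp ?_ (continuous_symbol c).continuousAt)
      rw [hξ]
      exact hφ.continuousAt (isOpen_compl_singleton.mem_nhds hs.2)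
    have hnear : ∀ᶠ η in nhds ξ, ‖(φ ∘ symbol c) η‖ < ε :=
      hc.eventually_lt continuousAt_const (by simpa [hξ] using hsε)
    obtain ⟨U, hU, hUo, hξU⟩ := eventually_nhds_iff.1 hnear
    -- By continuity one small value gives an open set of small values, which is not null.
    have hpos : 0 < volume U := hUo.measure_pos volume ⟨ξ, hξU⟩
    refine hpos.ne' (measure_mono_null (fun η hη => ?_) (ae_iff.1 h))
    exact not_le.2 (hU η hη)
  · intro h0
    obtain ⟨ε, hε, h⟩ : ∃ ε > 0, ∀ w ∈ φ '' verticalLine c, ε ≤ dist 0 w := by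
      rw [Metric.mem_closure_iff] at h0
      push Not at h0
      exact h0
    refine ⟨ε, hε, ?_⟩
    -- Only at `ξ = 0` can the symbol be the excluded point `1`.
    filter_upwards [compl_mem_ae_iff.2 (measure_singleton (0 : ℝ))] with ξ hξ
    simpa using h _ ⟨_, symbol_mem_verticalLine hξ, rfl⟩

/-- `0` is not a limit of values of `φ` on `s` if and only if `φ` has no zeros in `s` and does not
tend to `0` along any sequence of distinct points of `s`. -/
theorem zero_notMem_closure_image_iff {Y : Type*} {φ : Y → ℂ} {s : Set Y} :
    (0 : ℂ) ∉ closure (φ '' s) ↔ (∀ y ∈ s, φ y ≠ 0) ∧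
      ¬ ∃ u : ℕ → Y, Function.Injective u ∧ (∀ n, u n ∈ s) ∧
        Filter.Tendsto (fun n => φ (u n)) Filter.atTop (nhds 0) := by
  constructor
  · refine fun h => ⟨fun y hy h0 => h (subset_closure ⟨y, hy, h0⟩), ?_⟩
    rintro ⟨u, -, hus, hu⟩
    exact h (mem_closure_of_tendsto hu (Filter.Eventually.of_forall fun n => ⟨u n, hus n, rfl⟩))
  · rintro ⟨hne, hseq⟩ h0
    obtain ⟨v, hv, hlim⟩ := mem_closure_iff_seq_limit.1 h0
    choose u hus huv using hv
    have hv0 : ∀ n, v n ≠ 0 := fun n => huv n ▸ hne _ (hus n)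
    have hinv : Filter.Tendsto (fun n => ‖v n‖⁻¹) Filter.atTop Filter.atTop := by
      refine Filter.Tendsto.inv_tendsto_nhdsGT_zero (tendsto_nhdsWithin_iff.2 ⟨?_, ?_⟩)
      · simpa using hlim.norm
      · exact Filter.Eventually.of_forall fun n => norm_pos_iff.2 (hv0 n)
    -- Along a subsequence the norms of the nonzero values strictly decrease, so the points
    -- themselves are distinct.
    obtain ⟨k, hk, hkv⟩ := Filter.strictMono_subseq_of_tendsto_atTop hinv
    refine hseq ⟨u ∘ k, fun i j hij => hkv.injective ?_, fun n => hus _, ?_⟩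
    · simp only [Function.comp_apply] at hij ⊢
      rw [← huv, ← huv, hij]
    · simp only [Function.comp_apply, huv]
      exact hlim.comp hk.tendsto_atTop

end Zeta

end SpectralOp

end

theorem theorem6p4 (c : ℝ) (hc : 0 ≤ c) :
    SpectralOp.IsFunctionOf (SpectralOp.infinitesimalShift c) riemannZeta
      (SpectralOp.spectralOperator c) ∧
    (SpectralOp.IsInvertible (SpectralOp.spectralOperator c) ↔
      (0 : ℂ) ∉ closure (riemannZeta '' SpectralOp.verticalLine c)) ∧
    ((0 : ℂ) ∉ closure (riemannZeta '' SpectralOp.verticalLine c) ↔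
      (∀ s ∈ SpectralOp.verticalLine c, riemannZeta s ≠ 0) ∧
      ¬ ∃ s : ℕ → ℂ, Function.Injective s ∧ (∀ n, s n ∈ SpectralOp.verticalLine c) ∧
        Filter.Tendsto (fun n => riemannZeta (s n)) Filter.atTop (nhds 0)) := by
  have hζ := SpectralOp.measurable_riemannZeta
  have hz := (SpectralOp.continuous_symbol c).measurable
  have hop : SpectralOp.spectralOperator c =
      SpectralOp.mulOp (SpectralOp.diagonalization c) (riemannZeta ∘ SpectralOp.symbol c) := by
    rw [SpectralOp.spectralOperator, SpectralOp.infinitesimalShift_eq_mulOp,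
      SpectralOp.functionalCalculus_mulOp _ hz hζ]
  refine ⟨?_, ?_, SpectralOp.zero_notMem_closure_image_iff⟩
  · rw [hop, SpectralOp.infinitesimalShift_eq_mulOp]
    exact SpectralOp.isFunctionOf_mulOp _ hz hζ
  · rw [hop, SpectralOp.isInvertible_mulOp_iff _ (hζ.comp hz)]
    exact SpectralOp.exists_ae_le_norm_iff SpectralOp.continuousOn_riemannZeta c
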